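/- Fix a noise level $\delta\in(0,1)$. For $n,d\ge 1$ consider the following next-symbol prediction task with $n$ subpopulations, a sample of size $n$ and a uniform mixture. The problem instance $P=(c_1,\dots,c_n)$ consists of independent uniform reference strings $c_j\in\{0,1\}^d$. A labeled example $(z,y)$ from $P$ is drawn as follows: draw $j\in\{1,\dots,n\}$ and $\ell\in\{0,\dots,d-1\}$ independently and uniformly; the feature vector $z$ consists of $j$ and of the first $\ell$ bits of $c_j$, each flipped independently with probability $\delta/2$; the label $y$ is bit $\ell+1$ of $c_j$, flipped independently with probability $\delta/2$. The data set $X=(X_1,\dots,X_n)$ consists of $n$ i.i.d. labeled examples from $P$. A learner $A$ is a randomized algorithm that maps $X$ to a model $M=A(X)$ (in an arbitrary measurable space), and $M$ is interpreted as a possibly randomized map from feature vectors to labels; $\mathrm{err}(A)$ is the probability, over $P$, $X$, the coins of $A$ and $M$, and a fresh test example $(z,y)$ from $P$, that $M(z)\ne y$. The learner is $\epsilon$-suboptimal if $\mathrm{err}(A)\le \inf_{A'}\mathrm{err}(A')+\epsilon$, the infimum being over all learners. Let $S\subseteq\{1,\dots,n\}$ be the set of indices of the singletons, i.e. of the data points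 $X_i$ whose subpopulation contains no other data point. Let $X_S$ denote the set of examples $\{X_i : i\in S\}$, and $\vec X_S$ the family $(X_i)_{i\in S}$, which also records the positions of the singletons in $X$. Entropies and informations are in bits. 1. There is a constant $b>0$, depending only on $\delta$, such that $H(X_S\mid P)\ge b\,nd$ and $H(\vec X_S\mid P)\ge b\,nd$ for all $n,d\ge 1$. In particular both are $\Omega(nd)$. 2. Let $(n_k)$ and $(d_k)$ be any sequences of natural numbers with $n_k\ge 1$ and $d_k\to\infty$ (with no relation between the two rates), let $\epsilon_k\to 0$, and let $A_k$ be $\epsilon_k$-suboptimal for the task with parameters $n_k,d_k$. Then, as $k\to\infty$, $$I(X;M\mid P)\;\ge\;(1-o(1))\cdot H(X_S\mid P).$$ If moreover $\log n_k=o(d_k)$, then also $$I(X;M\mid P)\;\ge\;(1-o(1))\cdot H(\vec X_S\mid P).$$ -/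

import Mathlib

open MeasureTheory ProbabilityTheory Filter Topology

noncomputable section

universe u

namespace NSP

/-! ### Information measures (in bits) -/

open Classical in
/-- Shannon entropy, in bits, of the random variable `f` on a finite probability space `α` with
point masses `p`. -/
def entropy {α β : Type*} [Fintype α] (p : α → ℝ) (f : α → β) : ℝ :=
  (∑ b ∈ Finset.univ.image f, Real.negMulLog (∑ a ∈ Finset.univ.filter (fun a => f a = b), p a))
    / Real.log 2

/-- Mutual information `I(X;M)`, in bits, where `X` takes values in a finite set `α` (with the
discrete σ-algebra), has point masses `p`, and, given `X = a`, the variable `M` has law `κ a`: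
the Kullback-Leibler divergence of the joint law of `(X, M)` from the product of its marginals. -/
def mutualInfo {α 𝓜 : Type*} [Fintype α] [MeasurableSpace 𝓜] (p : α → ℝ) (κ : α → Measure 𝓜) : ℝ :=
  letI : MeasurableSpace α := ⊤
  (InformationTheory.klDiv
    (∑ a, ENNReal.ofReal (p a) • (Measure.dirac a).prod (κ a))
    ((∑ a, ENNReal.ofReal (p a) • Measure.dirac a).prod
      (∑ a, ENNReal.ofReal (p a) • κ a))).toReal / Real.log 2

/-! ### The next-symbol prediction task -/

/-- A problem instance `P`: one reference string in `{0,1}^d` for each of the `N` subpopulations.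
(The mixture coefficients are deterministically uniform.) -/
abbrev Instance (N d : ℕ) : Type := Fin N → Fin d → Bool

/-- Feature vectors: a subpopulation identifier and a binary string of length `ℓ < d`. -/
abbrev Input (N d : ℕ) : Type := Fin N × (Σ ℓ : Fin d, (Fin (ℓ : ℕ) → Bool))

/-- A feature vector together with its binary label. -/
abbrev Example (N d : ℕ) : Type := Input N d × Bool

/-- A data set of `n` labeled examples. -/
abbrev Dataset (N n d : ℕ) : Type := Fin n → Example N d

/-- The subpopulation identifier of an example. -/
def Example.id {N d : ℕ} (e : Example N d) : Fin N := e.1.1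

/-- The binary symmetric channel with flip probability `δ / 2`: the probability of output `b` on
input `a`. -/
def bsc (δ : ℝ) (a b : Bool) : ℝ := if b = a then 1 - δ / 2 else δ / 2

/-- Probability of the labeled example `((j, ℓ, z), y)` under the problem instance `c`: the
subpopulation `j` and the length `ℓ ∈ {0, …, d-1}` are uniform, `z` is a noisy copy of the first
`ℓ` bits of `c j`, and `y` is a noisy copy of the next bit. -/
def exampleProb {N d : ℕ} (δ : ℝ) (c : Instance N d) : Example N d → ℝ
  | ((j, ⟨ℓ, z⟩), y) =>
    (1 / (N : ℝ)) * (1 / (d : ℝ)) *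
      (∏ i : Fin (ℓ : ℕ), bsc δ (c j (Fin.castLE ℓ.isLt.le i)) (z i)) * bsc δ (c j ℓ) y

/-- Probability of the data set `x`, an i.i.d. sample from the problem instance `c`. -/
def dataProb {N n d : ℕ} (δ : ℝ) (c : Instance N d) (x : Dataset N n d) : ℝ :=
  ∏ i, exampleProb δ c (x i)

/-- Expectation over the random problem instance `P`: the reference strings are independent and
uniform in `{0,1}^d`. -/
def expInstance {N d : ℕ} (f : Instance N d → ℝ) : ℝ :=
  (∑ c, f c) / (Fintype.card (Instance N d) : ℝ)

/-! ### Learning algorithms -/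

/-- A randomized learning algorithm. On a data set `x` it outputs a model with law `train x` in an
arbitrary measurable space; a model `m` is interpreted as a randomized map from inputs to labels,
with label distribution `predict z m` on input `z`. -/
structure Learner (N n d : ℕ) where
  Model : Type u
  [measurableSpace : MeasurableSpace Model]
  train : Dataset N n d → Measure Model
  train_prob : ∀ x, IsProbabilityMeasure (train x)
  predict : Input N d → Kernel Model Bool
  predict_markov : ∀ z, IsMarkovKernel (predict z)

attribute [instance] Learner.measurableSpace

/-- The overall error: the probability that the label predicted by the model for a fresh test
example from `P` is wrong. -/
def err {N n d : ℕ} (δ : ℝ) (A : Learner.{u} N n d) : ℝ :=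
  expInstance fun c => ∑ x, dataProb δ c x * ∑ e : Example N d, exampleProb δ c e *
    ∫ m, (A.predict e.1 m).real {y | y ≠ e.2} ∂(A.train x)

/-- `A` is `ε`-suboptimal: its error exceeds the infimum over all learners by at most `ε`. -/
def IsSuboptimal {N n d : ℕ} (δ ε : ℝ) (A : Learner.{u} N n d) : Prop :=
  err δ A ≤ (⨅ A' : Learner.{u} N n d, err δ A') + ε

/-- `I(X; M | P)`, in bits. -/
def condMutualInfo {N n d : ℕ} (δ : ℝ) (A : Learner.{u} N n d) : ℝ :=
  expInstance fun c => mutualInfo (dataProb (n := n) δ c) A.train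

/-! ### Singletons -/

/-- The set `S` of indices of singleton data points: those that are the only representative of
their subpopulation in the data set. -/
def singletonIndices {N n d : ℕ} (x : Dataset N n d) : Finset (Fin n) :=
  Finset.univ.filter fun i => ∀ i', Example.id (x i') = Example.id (x i) → i' = i

/-- `X_S` as a subset of the data set. -/
def singletonSet {N n d : ℕ} (x : Dataset N n d) : Finset (Example N d) :=
  (singletonIndices x).image x

/-- `X_S` as the family `(X_i)_{i ∈ S}` indexed by the positions `S`; `none` marks the positions
outside `S`. -/
def singletonFamily {N n d : ℕ} (x : Dataset N n d) : Fin n → Option (Example N d) :=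
  fun i => if i ∈ singletonIndices x then some (x i) else none

/-- `H(X_S | P)`, in bits, for `X_S` the set of singletons. -/
def singletonSetEntropy (δ : ℝ) (N n d : ℕ) : ℝ :=
  expInstance (N := N) (d := d) fun c => entropy (dataProb (n := n) δ c) singletonSet

/-- `H(X_S | P)`, in bits, for `X_S` the indexed family of singletons. -/
def singletonFamilyEntropy (δ : ℝ) (N n d : ℕ) : ℝ :=
  expInstance (N := N) (d := d) fun c => entropy (dataProb (n := n) δ c) singletonFamily

end NSP

end

/-!
The argument works with natural logarithms and for a fixed problem instance `c`; averaging over `c`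
comes last. Write `G` for `featInfo`, the expected information content of the feature bits of the
singletons under the noise of the channel. Both the entropies and the mutual information are
compared with `G`, and are bounded variationally, so that no conditional entropies and no chain rule
are needed.

*Entropy.* Gibbs' inequality with an explicit coding distribution gives
`H(X_S) ≤ G + O(n (1 + log d))` for the set of singletons, and an additional `n log n` pays for
their positions (`entropy_singletonSet_le`, `entropy_singletonFamily_le`). Conversely, the set of
singletons determines their noisy bits and labels, so a reconstruction of the data from it shows
that its entropy is at least the information content of those bits, which is of order `n d` because
a constant fraction of the examples are singletons (`le_entropy_of_determines`,
`entropyRate_mul_le`).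

*Information.* For every conditional likelihood of the data given the model there is a lower bound
on the mutual information (`le_mutualInfo`). The likelihood used here keeps the law of the data
given the instance, except that bit `k` of a singleton of subpopulation `j` is read off from the
smoothed prediction of the model on an independent noisy prefix of `c j` of length `k`. This gives
`I(X; M) ≥ G + n d log (1 - t) + E log t`, where `t` is the smoothing parameter and `E` is the
expected number of bits of the singletons that the model mispredicts (`le_mutualInfo_train`).

*Suboptimality.* Replacing the predictions of a learner by the bit stored in a singleton, wherever
there is one, lowers its error by exactly `(1 - δ) ^ 2 / (n d)` times the average of `E`
(`sum_predErr_sub`): given the data and a test prefix, the stored bit and the test label are two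
noisy copies of a uniform bit on which nothing else depends, as pairing each instance with the one
where that bit is flipped shows. Hence an `ε`-suboptimal learner has `E ≤ ε n d / (1 - δ) ^ 2` on
average, and letting `ε → 0` before `t → 0` makes the loss `o(n d)`.
-/

noncomputable section

universe u

namespace NSP

/-! ### Variational bounds for information measures -/

/-- The Donsker-Varadhan lower bound on the Kullback-Leibler divergence. -/
theorem integral_le_toReal_klDiv {Ω : Type*} [MeasurableSpace Ω] {μ ν : Measure Ω}
    [IsProbabilityMeasure μ] [IsProbabilityMeasure ν]
    (hac : μ ≪ ν) (hllr : Integrable (llr μ ν) μ) {f : Ω → ℝ} (hf : Measurable f) {C : ℝ}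
    (hC : ∀ ω, |f ω| ≤ C) (hexp : ∫ ω, Real.exp (f ω) ∂ν ≤ 1) :
    ∫ ω, f ω ∂μ ≤ (InformationTheory.klDiv μ ν).toReal := by
  have hfμ : Integrable f μ :=
    Integrable.of_bound hf.aestronglyMeasurable C (Eventually.of_forall hC)
  have hfν : Integrable (fun ω => Real.exp (f ω)) ν := by
    refine Integrable.of_bound (Real.measurable_exp.comp hf).aestronglyMeasurable (Real.exp C)
      (Eventually.of_forall fun ω => ?_)
    rw [Real.norm_eq_abs, Real.abs_exp]
    exact Real.exp_le_exp.2 ((le_abs_self _).trans (hC ω))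
  have : IsProbabilityMeasure (ν.tilted f) := isProbabilityMeasure_tilted hfν
  have h0 := InformationTheory.integral_llr_add_sub_measure_univ_nonneg
    (hac.trans (absolutelyContinuous_tilted hfν)) (integrable_llr_tilted_right hac hfμ hllr hfν)
  rw [integral_llr_tilted_right hac hfμ hfν hllr] at h0
  have hlog : Real.log (∫ ω, Real.exp (f ω) ∂ν) ≤ 0 :=
    Real.log_nonpos (integral_nonneg fun _ => (Real.exp_pos _).le) hexp
  rw [InformationTheory.toReal_klDiv_of_measure_eq hac (by simp)]
  simp only [probReal_univ] at h0
  linarith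

/-- A measure dominated by a multiple of `ν` has finite divergence from `ν`. -/
theorem integrable_llr_of_le_smul {Ω : Type*} [MeasurableSpace Ω] {μ ν : Measure Ω}
    [IsFiniteMeasure μ] [IsFiniteMeasure ν] {c : NNReal} (hc : c ≠ 0) (h : c • μ ≤ ν) :
    μ ≪ ν ∧ Integrable (llr μ ν) μ := by
  have hac : μ ≪ ν := by
    refine Measure.AbsolutelyContinuous.trans ?_ (Measure.absolutelyContinuous_of_le h)
    exact Measure.absolutelyContinuous_smul (c := (c : ENNReal)) (by simpa using hc)
  refine ⟨hac, (InformationTheory.integrable_klFun_rnDeriv_iff hac).1 ?_⟩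
  obtain ⟨K, hK⟩ := (isCompact_Icc (a := (0 : ℝ)) (b := ((c : ℝ))⁻¹)).exists_bound_of_continuousOn
    InformationTheory.continuous_klFun.continuousOn
  have hc0 : (0 : ℝ) < c := by positivity
  refine Integrable.of_bound (InformationTheory.measurable_klFun.comp
    (Measure.measurable_rnDeriv μ ν).ennreal_toReal).aestronglyMeasurable K ?_
  filter_upwards [Measure.rnDeriv_le_one_of_le h, Measure.rnDeriv_smul_left μ ν c] with ω h1 h2
  refine hK _ ⟨ENNReal.toReal_nonneg, ?_⟩
  rw [h2] at h1
  have h3 : (c : ℝ) * (μ.rnDeriv ν ω).toReal ≤ 1 := by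
    have := ENNReal.toReal_mono (by simp) h1
    simpa [ENNReal.smul_def] using this
  rw [← one_div, le_div_iff₀ hc0]
  linarith

/-- A lower bound on mutual information by reconstruction: for any conditional likelihood
`p a * exp (φ a m)` of the data `a` given the model `m`, of total mass at most one for each `m`,
the expectation of `φ` is at most the information (in nats) that the model holds on the data. -/
theorem le_mutualInfo {α 𝓜 : Type*} [Fintype α] [MeasurableSpace 𝓜] {p : α → ℝ}
    (hp : ∀ a, 0 < p a) (hsum : ∑ a, p a = 1) (κ : α → Measure 𝓜)
    [∀ a, IsProbabilityMeasure (κ a)] {φ : α → 𝓜 → ℝ} (hφ : ∀ a, Measurable (φ a))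
    (hbdd : ∀ a, ∃ C, ∀ m, |φ a m| ≤ C) (hexp : ∀ m, ∑ a, p a * Real.exp (φ a m) ≤ 1) :
    ∑ a, p a * ∫ m, φ a m ∂κ a ≤ mutualInfo p κ * Real.log 2 := by
  let _ : MeasurableSpace α := ⊤
  obtain ⟨C, hC⟩ : ∃ C, ∀ a m, |φ a m| ≤ C := by
    choose K hK using hbdd
    exact ⟨∑ a, |K a|, fun a m => (hK a m).trans <| (le_abs_self _).trans <|
      Finset.single_le_sum (f := fun a => |K a|) (fun _ _ => abs_nonneg _) (Finset.mem_univ a)⟩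
  have hlog2 : Real.log 2 ≠ 0 := (Real.log_pos one_lt_two).ne'
  have hne : Nonempty α := by
    by_contra h
    rw [not_nonempty_iff] at h
    simp at hsum
  obtain ⟨a₀, ha₀⟩ := Finite.exists_min p
  have hsum' : ∑ a, ENNReal.ofReal (p a) = 1 := by
    rw [← ENNReal.ofReal_sum_of_nonneg fun a _ => (hp a).le, hsum, ENNReal.ofReal_one]
  set μ₁ : Measure α := ∑ a, ENNReal.ofReal (p a) • Measure.dirac a with hμ₁
  set μ₂ : Measure 𝓜 := ∑ a, ENNReal.ofReal (p a) • κ a with hμ₂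
  set J : Measure (α × 𝓜) := ∑ a, ENNReal.ofReal (p a) • (Measure.dirac a).prod (κ a) with hJ
  have : IsProbabilityMeasure μ₁ := ⟨by simp [hμ₁, hsum']⟩
  have : IsProbabilityMeasure μ₂ := ⟨by simp [hμ₂, hsum']⟩
  have : IsProbabilityMeasure J := ⟨by simp [hJ, hsum']⟩
  have hF : Measurable fun x : α × 𝓜 => φ x.1 x.2 := measurable_from_prod_countable_right hφ
  have hdom : (p a₀).toNNReal • J ≤ μ₁.prod μ₂ := by
    refine Measure.le_iff.2 fun s hs => ?_
    rw [Measure.prod_apply hs, hμ₁, lintegral_finsetSum_measure]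
    simp only [lintegral_smul_measure, lintegral_dirac, Measure.smul_apply, hJ,
      Measure.finsetSum_apply, Finset.smul_sum]
    refine Finset.sum_le_sum fun a _ => ?_
    rw [Measure.dirac_prod, Measure.map_apply measurable_prodMk_left hs, smul_comm]
    refine mul_le_mul_right ?_ _
    rw [hμ₂, Measure.finsetSum_apply]
    refine le_trans ?_ (Finset.single_le_sum (fun _ _ => zero_le) (Finset.mem_univ a))
    rw [Measure.smul_apply]
    exact mul_le_mul_left (ENNReal.ofReal_le_ofReal (ha₀ a)) _
  obtain ⟨hac, hllr⟩ := integrable_llr_of_le_smul (by simpa using hp a₀) hdom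
  have hint : Integrable (fun x : α × 𝓜 => Real.exp (φ x.1 x.2)) (μ₁.prod μ₂) := by
    refine Integrable.of_bound (Real.measurable_exp.comp hF).aestronglyMeasurable (Real.exp C)
      (Eventually.of_forall fun x => ?_)
    rw [Real.norm_eq_abs, Real.abs_exp]
    exact Real.exp_le_exp.2 ((le_abs_self _).trans (hC _ _))
  have hQ : ∫ x, Real.exp (φ x.1 x.2) ∂(μ₁.prod μ₂) ≤ 1 := by
    rw [integral_prod_symm _ hint]
    have : ∀ m, ∫ a, Real.exp (φ a m) ∂μ₁ ≤ 1 := fun m => by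
      rw [hμ₁, integral_finsetSum_measure fun a _ =>
        (integrable_dirac (by simp)).smul_measure ENNReal.ofReal_ne_top]
      simpa [ENNReal.toReal_ofReal (hp _).le] using hexp m
    calc _ ≤ ∫ _, (1 : ℝ) ∂μ₂ :=
          integral_mono hint.integral_prod_right (integrable_const 1) this
      _ = 1 := by simp
  have hφint : ∀ a, Integrable (φ a) (κ a) := fun a =>
    Integrable.of_bound (hφ a).aestronglyMeasurable C (Eventually.of_forall (hC a))
  have hJint : ∫ x, φ x.1 x.2 ∂J = ∑ a, p a * ∫ m, φ a m ∂κ a := by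
    have hFi : ∀ a, Integrable (fun x : α × 𝓜 => φ x.1 x.2) ((Measure.dirac a).prod (κ a)) :=
      fun a => Integrable.of_bound hF.aestronglyMeasurable C (Eventually.of_forall fun _ => hC _ _)
    rw [hJ, integral_finsetSum_measure fun a _ => (hFi a).smul_measure ENNReal.ofReal_ne_top]
    refine Finset.sum_congr rfl fun a _ => ?_
    rw [integral_smul_measure, Measure.dirac_prod,
      integral_map measurable_prodMk_left.aemeasurable hF.aestronglyMeasurable,
      ENNReal.toReal_ofReal (hp a).le, smul_eq_mul]
  rw [← hJint, mutualInfo, div_mul_cancel₀ _ hlog2]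
  exact integral_le_toReal_klDiv hac hllr hF (fun _ => hC _ _) hQ

theorem mutualInfo_nonneg {α 𝓜 : Type*} [Fintype α] [MeasurableSpace 𝓜] (p : α → ℝ)
    (κ : α → Measure 𝓜) : 0 ≤ mutualInfo p κ :=
  div_nonneg ENNReal.toReal_nonneg (Real.log_nonneg one_le_two)

/-- Gibbs' inequality: the entropy is at most the cross entropy relative to `q`. -/
theorem entropy_mul_log_two_le {α β : Type*} [Fintype α] [Fintype β] {p : α → ℝ}
    (hp : ∀ a, 0 ≤ p a) (hsum : ∑ a, p a = 1) (f : α → β) {q : β → ℝ} (hq : ∀ b, 0 < q b)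
    (hqsum : ∑ b, q b ≤ 1) :
    entropy p f * Real.log 2 ≤ ∑ a, p a * -Real.log (q (f a)) := by
  classical
  rw [entropy, div_mul_cancel₀ _ (Real.log_pos one_lt_two).ne']
  set P : β → ℝ := fun b => ∑ a with f a = b, p a
  have hfib : ∀ g : β → ℝ, ∑ b ∈ Finset.univ.image f, P b * g b = ∑ a, p a * g (f a) := by
    intro g
    rw [← Finset.sum_fiberwise_of_maps_to (s := Finset.univ) (t := Finset.univ.image f) (g := f)
      fun a _ => Finset.mem_image_of_mem f (Finset.mem_univ a)]
    refine Finset.sum_congr rfl fun b _ => ?_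
    rw [Finset.sum_mul]
    refine Finset.sum_congr rfl fun a ha => ?_
    rw [(Finset.mem_filter.1 ha).2]
  have hP0 : ∀ b, 0 ≤ P b := fun b => Finset.sum_nonneg fun a _ => hp a
  have hterm : ∀ b, Real.negMulLog (P b) ≤ P b * -Real.log (q b) + (q b - P b * 1) := by
    intro b
    rcases (hP0 b).eq_or_lt with h | h
    · simp [← h, (hq b).le]
    · have h1 := Real.log_le_sub_one_of_pos (div_pos (hq b) h)
      rw [Real.log_div (hq b).ne' h.ne'] at h1
      have h2 := mul_le_mul_of_nonneg_left h1 h.le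
      rw [mul_sub (P b) (q b / P b), mul_div_cancel₀ _ h.ne'] at h2
      rw [Real.negMulLog]
      linarith
  calc _ ≤ ∑ b ∈ Finset.univ.image f, (P b * -Real.log (q b) + (q b - P b * 1)) :=
        Finset.sum_le_sum fun b _ => by convert hterm b
    _ = ∑ a, p a * -Real.log (q (f a)) + (∑ b ∈ Finset.univ.image f, q b - 1) := by
        rw [Finset.sum_add_distrib, Finset.sum_sub_distrib, hfib, hfib fun _ => 1]
        simp [hsum]
    _ ≤ _ := by
        have : ∑ b ∈ Finset.univ.image f, q b ≤ ∑ b, q b :=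
          Finset.sum_le_sum_of_subset_of_nonneg (Finset.subset_univ _) fun b _ _ => (hq b).le
        linarith

/-- The analogue for entropy of `le_mutualInfo`: a reconstruction likelihood `q b` of the outcome
`a` from the value `b = f a` bounds the entropy of `f` from below. -/
theorem le_entropy_mul_log_two {α β : Type*} [Fintype α] {p : α → ℝ}
    (hp : ∀ a, 0 ≤ p a) (hsum : ∑ a, p a = 1) (f : α → β) {q : β → α → ℝ}
    (hq : ∀ b a, 0 ≤ q b a) (hqsum : ∀ b, ∑ a, q b a ≤ 1) {ψ : α → ℝ}
    (hψ : ∀ a, p a * Real.exp (ψ a) ≤ q (f a) a) :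
    ∑ a, p a * ψ a ≤ entropy p f * Real.log 2 := by
  classical
  rw [entropy, div_mul_cancel₀ _ (Real.log_pos one_lt_two).ne']
  set P : β → ℝ := fun b => ∑ a with f a = b, p a with hP
  have hfib : ∀ g : α → ℝ, ∑ b ∈ Finset.univ.image f, ∑ a with f a = b, g a = ∑ a, g a :=
    fun g => Finset.sum_fiberwise_of_maps_to
      (fun a _ => Finset.mem_image_of_mem f (Finset.mem_univ a)) g
  have hP0 : ∀ b, 0 ≤ P b := fun b => Finset.sum_nonneg fun a _ => hp a
  have hPsum : ∑ b ∈ Finset.univ.image f, P b = 1 := (hfib p).trans hsum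
  have hterm : ∀ a, p a * ψ a ≤ p a * -Real.log (P (f a)) + (P (f a) * q (f a) a - p a) := by
    intro a
    rcases (hp a).eq_or_lt with h | h
    · simpa [← h] using mul_nonneg (hP0 _) (hq _ _)
    · have hPa : 0 < P (f a) := h.trans_le
        (Finset.single_le_sum (f := p) (fun a _ => hp a) (by simp))
      have h1 := Real.add_one_le_exp (ψ a + Real.log (P (f a)))
      rw [Real.exp_add, Real.exp_log hPa] at h1
      have h2 := mul_le_mul_of_nonneg_left h1 h.le
      have h3 := mul_le_mul_of_nonneg_left (hψ a) hPa.le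
      nlinarith
  have hent : ∑ a, p a * -Real.log (P (f a)) =
      ∑ b ∈ Finset.univ.image f, Real.negMulLog (P b) := by
    rw [← hfib]
    refine Finset.sum_congr rfl fun b _ => ?_
    rw [Real.negMulLog, neg_mul, ← mul_neg, hP, Finset.sum_mul]
    exact Finset.sum_congr rfl fun a ha => by rw [(Finset.mem_filter.1 ha).2]
  have hrest : ∑ a, P (f a) * q (f a) a ≤ 1 := by
    rw [← hfib, ← hPsum]
    refine Finset.sum_le_sum fun b _ => ?_
    calc ∑ a with f a = b, P (f a) * q (f a) a = P b * ∑ a with f a = b, q b a := by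
          rw [Finset.mul_sum]
          exact Finset.sum_congr rfl fun a ha => by rw [(Finset.mem_filter.1 ha).2]
      _ ≤ P b * 1 := by
          refine mul_le_mul_of_nonneg_left (le_trans ?_ (hqsum b)) (hP0 b)
          exact Finset.sum_le_sum_of_subset_of_nonneg (Finset.subset_univ _) fun a _ _ => hq b a
      _ = P b := mul_one _
  calc _ ≤ ∑ a, (p a * -Real.log (P (f a)) + (P (f a) * q (f a) a - p a)) :=
        Finset.sum_le_sum fun a _ => hterm a
    _ = ∑ b ∈ Finset.univ.image f, Real.negMulLog (P b) + (∑ a, P (f a) * q (f a) a - 1) := by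
        rw [Finset.sum_add_distrib, Finset.sum_sub_distrib, hent, hsum]
    _ ≤ ∑ b ∈ Finset.univ.image f, Real.negMulLog (P b) := by linarith
    _ = _ := by
        refine Finset.sum_congr rfl fun b _ => ?_
        congr 1

/-! ### Products of bit probabilities -/

variable {N n d : ℕ}

/-- The position, in the reference string, of bit `i` of a feature vector of length `ℓ < d`. -/
abbrev pos {ℓ : Fin d} (i : Fin (ℓ : ℕ)) : Fin d := Fin.castLE ℓ.isLt.le i

/-- The probability of the string of a feature vector when its bits are independent, bit `k` of
a string of subpopulation `j` having the law `w j k`. -/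
def bitProb (w : Fin N → Fin d → Bool → ℝ) (z : Input N d) : ℝ :=
  ∏ i : Fin (z.2.1 : ℕ), w z.1 (pos i) (z.2.2 i)

/-- The law of the bits of a noisy copy of the reference strings `c`. -/
def noisyBit (δ : ℝ) (c : Instance N d) (j : Fin N) (k : Fin d) : Bool → ℝ := bsc δ (c j k)

/-- The probability of an example with uniform subpopulation and length, independent feature bits
with laws `w` and label with law `v`. -/
def predictiveProb (w v : Fin N → Fin d → Bool → ℝ) (e : Example N d) : ℝ :=
  (1 / (N : ℝ)) * (1 / (d : ℝ)) * bitProb w e.1 * v e.1.1 e.1.2.1 e.2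

/-- A family of laws on `Bool`, one for each position of each reference string. -/
structure IsBitLaw (w : Fin N → Fin d → Bool → ℝ) : Prop where
  nonneg : ∀ j k b, 0 ≤ w j k b
  sum_eq : ∀ j k, ∑ b, w j k b = 1

theorem exampleProb_eq (δ : ℝ) (c : Instance N d) (e : Example N d) :
    exampleProb δ c e = predictiveProb (noisyBit δ c) (noisyBit δ c) e := rfl

theorem bsc_pos {δ : ℝ} (h0 : 0 < δ) (h1 : δ < 1) (a b : Bool) : 0 < bsc δ a b := by
  unfold bsc; split_ifs <;> linarith

theorem noisyBit_pos {δ : ℝ} (h0 : 0 < δ) (h1 : δ < 1) (c : Instance N d) (j : Fin N)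
    (k : Fin d) (b : Bool) : 0 < noisyBit δ c j k b := bsc_pos h0 h1 _ _

theorem le_noisyBit {δ : ℝ} (h1 : δ < 1) (c : Instance N d) (j : Fin N) (k : Fin d) (b : Bool) :
    δ / 2 ≤ noisyBit δ c j k b := by
  unfold noisyBit bsc; split_ifs <;> linarith

theorem noisyBit_le {δ : ℝ} (h1 : δ < 1) (c : Instance N d) (j : Fin N) (k : Fin d) (b : Bool) :
    noisyBit δ c j k b ≤ 1 - δ / 2 := by
  unfold noisyBit bsc; split_ifs <;> linarith

theorem isBitLaw_noisyBit {δ : ℝ} (h0 : 0 < δ) (h1 : δ < 1) (c : Instance N d) :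
    IsBitLaw (noisyBit δ c) where
  nonneg _ _ _ := (bsc_pos h0 h1 _ _).le
  sum_eq j k := by
    unfold noisyBit
    cases c j k <;> simp [bsc]

theorem bitProb_pos {δ : ℝ} (h0 : 0 < δ) (h1 : δ < 1) (c : Instance N d) (z : Input N d) :
    0 < bitProb (noisyBit δ c) z := Finset.prod_pos fun _ _ => bsc_pos h0 h1 _ _

theorem exampleProb_pos {δ : ℝ} (h0 : 0 < δ) (h1 : δ < 1) (hN : 1 ≤ N) (c : Instance N d)
    (e : Example N d) : 0 < exampleProb δ c e := by
  rw [exampleProb_eq, predictiveProb]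
  have hd : 0 < d := (Nat.zero_le _).trans_lt e.1.2.1.isLt
  have := bitProb_pos h0 h1 c e.1
  have := bsc_pos h0 h1 (c e.1.1 e.1.2.1) e.2
  unfold noisyBit at *
  positivity

theorem dataProb_pos {δ : ℝ} (h0 : 0 < δ) (h1 : δ < 1) (hN : 1 ≤ N) (c : Instance N d)
    (x : Dataset N n d) : 0 < dataProb δ c x :=
  Finset.prod_pos fun _ _ => exampleProb_pos h0 h1 hN c _

theorem IsBitLaw.bitProb_nonneg {w : Fin N → Fin d → Bool → ℝ} (hw : IsBitLaw w)
    (z : Input N d) : 0 ≤ bitProb w z := Finset.prod_nonneg fun _ _ => hw.nonneg _ _ _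

theorem IsBitLaw.sum_bitProb {w : Fin N → Fin d → Bool → ℝ} (hw : IsBitLaw w) (j : Fin N)
    (k : Fin d) : ∑ z : Fin (k : ℕ) → Bool, bitProb w (j, ⟨k, z⟩) = 1 := by
  unfold bitProb
  have := Finset.prod_univ_sum (fun _ : Fin (k : ℕ) => (Finset.univ : Finset Bool))
    fun i b => w j (pos i) b
  rw [Fintype.piFinset_univ] at this
  rw [← this]
  simp only [hw.sum_eq, Finset.prod_const_one]

theorem predictiveProb_nonneg {w v : Fin N → Fin d → Bool → ℝ} (hw : IsBitLaw w)
    (hv : IsBitLaw v) (e : Example N d) : 0 ≤ predictiveProb w v e := by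
  have := hw.bitProb_nonneg e.1
  have := hv.nonneg e.1.1 e.1.2.1 e.2
  unfold predictiveProb
  positivity

theorem sum_example {R : Type*} [AddCommMonoid R] (f : Example N d → R) :
    ∑ e, f e = ∑ j, ∑ k : Fin d, ∑ z : Fin (k : ℕ) → Bool, ∑ b, f ((j, ⟨k, z⟩), b) := by
  rw [Fintype.sum_prod_type, Fintype.sum_prod_type]
  refine Finset.sum_congr rfl fun j _ => ?_
  rw [Fintype.sum_sigma]

/-- Integrating out the bits of an example leaves a uniform subpopulation and length. -/
theorem sum_predictiveProb_mul {w v : Fin N → Fin d → Bool → ℝ} (hw : IsBitLaw w)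
    (hv : IsBitLaw v) (h : Fin N → Fin d → ℝ) :
    ∑ e : Example N d, predictiveProb w v e * h e.1.1 e.1.2.1 =
      ∑ j, ∑ k, (1 / (N : ℝ)) * (1 / (d : ℝ)) * h j k := by
  rw [sum_example]
  refine Finset.sum_congr rfl fun j _ => Finset.sum_congr rfl fun k _ => ?_
  have : ∀ z : Fin (k : ℕ) → Bool, ∑ b, predictiveProb w v ((j, ⟨k, z⟩), b) * h j k =
      bitProb w (j, ⟨k, z⟩) * ((1 / (N : ℝ)) * (1 / (d : ℝ)) * h j k) := by
    intro z
    have hs : ∑ b, predictiveProb w v ((j, ⟨k, z⟩), b) * h j k =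
      (1 / (N : ℝ)) * (1 / (d : ℝ)) * bitProb w (j, ⟨k, z⟩) * h j k * ∑ b, v j k b := by
      rw [Finset.mul_sum]
      refine Finset.sum_congr rfl fun b _ => ?_
      simp only [predictiveProb]; ring
    rw [hs, hv.sum_eq]; ring
  simp only [this]
  rw [← Finset.sum_mul, hw.sum_bitProb, one_mul]

theorem sum_predictiveProb_id {w v : Fin N → Fin d → Bool → ℝ} (hw : IsBitLaw w)
    (hv : IsBitLaw v) (hd : 1 ≤ d) (j : Fin N) :
    ∑ e : Example N d, (if e.id = j then predictiveProb w v e else 0) = 1 / (N : ℝ) := by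
  have h := sum_predictiveProb_mul hw hv fun j' _ => if j' = j then 1 else 0
  simp only [mul_ite, mul_one, mul_zero] at h
  refine h.trans ?_
  have : (d : ℝ) ≠ 0 := by positivity
  rw [Finset.sum_comm]
  simp
  field_simp

theorem sum_exampleProb {δ : ℝ} (h0 : 0 < δ) (h1 : δ < 1) (hN : 1 ≤ N) (hd : 1 ≤ d)
    (c : Instance N d) : ∑ e, exampleProb δ c e = 1 := by
  have hb := isBitLaw_noisyBit h0 h1 c
  have h := sum_predictiveProb_mul hb hb fun _ _ => 1
  have : (d : ℝ) ≠ 0 := by positivity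
  have : (N : ℝ) ≠ 0 := by positivity
  simp only [mul_one] at h
  refine h.trans ?_
  simp
  field_simp

/-! ### Data sets and their singletons -/

theorem sum_prod_dataset (f : Fin n → Example N d → ℝ) :
    ∑ x : Dataset N n d, ∏ i, f i (x i) = ∏ i, ∑ e, f i e := by
  rw [Finset.prod_univ_sum, Fintype.piFinset_univ]

theorem sum_dataProb {δ : ℝ} (h0 : 0 < δ) (h1 : δ < 1) (hN : 1 ≤ N) (hd : 1 ≤ d)
    (c : Instance N d) : ∑ x : Dataset N n d, dataProb δ c x = 1 := by
  unfold dataProb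
  rw [sum_prod_dataset]
  simp [sum_exampleProb h0 h1 hN hd]

theorem mem_singletonIndices {x : Dataset N n d} {i : Fin n} :
    i ∈ singletonIndices x ↔ ∀ i', (x i').id = (x i).id → i' = i := by
  simp [singletonIndices]

theorem id_injOn_singletonIndices (x : Dataset N n d) :
    Set.InjOn (fun i => (x i).id) (singletonIndices x : Set (Fin n)) := fun i _ _ hi' h =>
  mem_singletonIndices.1 (Finset.mem_coe.1 hi') i h

theorem card_singletonIndices_le (x : Dataset N n d) : (singletonIndices x).card ≤ n := by
  simpa using Finset.card_le_univ (singletonIndices x)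

/-- The reconstruction law of a data set, given an instance `c` and predictions `w`, `v` of the
feature bits and labels of the singletons: the subpopulations are uniform, singletons follow the
predictions, and all other examples follow the law prescribed by `c`. -/
def reconProb (δ : ℝ) (c : Instance N d) (w v : Fin N → Fin d → Bool → ℝ)
    (x : Dataset N n d) : ℝ :=
  ∏ i, if i ∈ singletonIndices x then predictiveProb w v (x i) else exampleProb δ c (x i)

theorem reconProb_nonneg {δ : ℝ} (h0 : 0 < δ) (h1 : δ < 1) (hN : 1 ≤ N) (c : Instance N d)
    {w v : Fin N → Fin d → Bool → ℝ} (hw : IsBitLaw w) (hv : IsBitLaw v) (x : Dataset N n d) :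
    0 ≤ reconProb δ c w v x := by
  refine Finset.prod_nonneg fun i _ => ?_
  split_ifs
  exacts [predictiveProb_nonneg hw hv _, (exampleProb_pos h0 h1 hN _ _).le]

theorem sum_reconProb {δ : ℝ} (h0 : 0 < δ) (h1 : δ < 1) (hN : 1 ≤ N) (hd : 1 ≤ d)
    (c : Instance N d) {w v : Fin N → Fin d → Bool → ℝ} (hw : IsBitLaw w) (hv : IsBitLaw v) :
    ∑ x : Dataset N n d, reconProb δ c w v x = 1 := by
  classical
  -- Given the vector `J` of subpopulations, the set of singletons is fixed and the examples
  -- are independent.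
  set F : (Fin n → Fin N) → Fin n → Example N d → ℝ := fun J i e =>
    if ∀ i', J i' = J i → i' = i then predictiveProb w v e else exampleProb δ c e with hF
  have hsplit : ∀ x : Dataset N n d, reconProb δ c w v x =
      ∑ J : Fin n → Fin N, ∏ i, if (x i).id = J i then F J i (x i) else 0 := by
    intro x
    rw [Finset.sum_eq_single fun i => (x i).id]
    · simp [reconProb, hF, mem_singletonIndices]
    · intro J _ hJ
      obtain ⟨i, hi⟩ := Function.ne_iff.1 hJ
      exact Finset.prod_eq_zero (Finset.mem_univ i) (if_neg (Ne.symm hi))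
    · simp
  simp only [hsplit]
  rw [Finset.sum_comm]
  have hfac : ∀ (J : Fin n → Fin N) (i : Fin n),
      ∑ e : Example N d, (if e.id = J i then F J i e else 0) = 1 / (N : ℝ) := by
    intro J i
    simp only [hF]
    split_ifs
    · exact sum_predictiveProb_id hw hv hd _
    · exact sum_predictiveProb_id (isBitLaw_noisyBit h0 h1 c) (isBitLaw_noisyBit h0 h1 c) hd _
  have hN' : (N : ℝ) ≠ 0 := by positivity
  have : ∀ J : Fin n → Fin N, ∑ x : Dataset N n d,
      (∏ i, if (x i).id = J i then F J i (x i) else 0) = (1 / (N : ℝ)) ^ n := by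
    intro J
    rw [sum_prod_dataset fun i e => if e.id = J i then F J i e else 0]
    simp [hfac]
  simp only [this]
  simp [hN']

theorem dataProb_mul_exp_le_reconProb {δ : ℝ} (h0 : 0 < δ) (h1 : δ < 1) (hN : 1 ≤ N)
    (c : Instance N d) {w v : Fin N → Fin d → Bool → ℝ} {ψ : Example N d → ℝ}
    {x : Dataset N n d}
    (hψ : ∀ i ∈ singletonIndices x,
      exampleProb δ c (x i) * Real.exp (ψ (x i)) ≤ predictiveProb w v (x i)) :
    dataProb δ c x * Real.exp (∑ i ∈ singletonIndices x, ψ (x i)) ≤ reconProb δ c w v x := by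
  rw [Real.exp_sum, ← Finset.prod_ite_mem_eq, dataProb, ← Finset.prod_mul_distrib]
  refine Finset.prod_le_prod (fun i _ => ?_) fun i _ => ?_
  · have := exampleProb_pos h0 h1 hN c (x i)
    split_ifs <;> positivity
  · split_ifs with hi
    · exact hψ i hi
    · simp

/-! ### Coding costs of an example -/

/-- The information content, in nats, of the feature bits of an example given the instance. -/
def featCost (δ : ℝ) (c : Instance N d) (e : Example N d) : ℝ :=
  ∑ i : Fin (e.1.2.1 : ℕ), -Real.log (noisyBit δ c e.1.1 (pos i) (e.1.2.2 i))

/-- The information content, in nats, of the label of an example given the instance. -/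
def labelCost (δ : ℝ) (c : Instance N d) (e : Example N d) : ℝ :=
  -Real.log (noisyBit δ c e.1.1 e.1.2.1 e.2)

theorem bitProb_mul_exp_featCost {δ : ℝ} (h0 : 0 < δ) (h1 : δ < 1) (c : Instance N d)
    (e : Example N d) : bitProb (noisyBit δ c) e.1 * Real.exp (featCost δ c e) = 1 := by
  rw [featCost, Real.exp_sum, bitProb, ← Finset.prod_mul_distrib]
  refine Finset.prod_eq_one fun i _ => ?_
  rw [Real.exp_neg, Real.exp_log (noisyBit_pos h0 h1 _ _ _ _)]
  exact mul_inv_cancel₀ (noisyBit_pos h0 h1 _ _ _ _).ne'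

theorem noisyBit_mul_exp_labelCost {δ : ℝ} (h0 : 0 < δ) (h1 : δ < 1) (c : Instance N d)
    (e : Example N d) :
    noisyBit δ c e.1.1 e.1.2.1 e.2 * Real.exp (labelCost δ c e) = 1 := by
  rw [labelCost, Real.exp_neg, Real.exp_log (noisyBit_pos h0 h1 _ _ _ _)]
  exact mul_inv_cancel₀ (noisyBit_pos h0 h1 _ _ _ _).ne'

/-- The expected information content of the feature bits of the singletons, in nats. -/
def featInfo (δ : ℝ) (n : ℕ) (c : Instance N d) : ℝ :=
  ∑ x : Dataset N n d, dataProb δ c x * ∑ i ∈ singletonIndices x, featCost δ c (x i)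

/-! ### Upper bounds on the entropy of the singletons -/

theorem neg_log_exampleProb {δ : ℝ} (h0 : 0 < δ) (h1 : δ < 1) (hN : 1 ≤ N) (c : Instance N d)
    (e : Example N d) : -Real.log (exampleProb δ c e) =
      Real.log N + Real.log d + featCost δ c e + labelCost δ c e := by
  have hd : 0 < d := (Nat.zero_le _).trans_lt e.1.2.1.isLt
  have hf := congrArg Real.log (bitProb_mul_exp_featCost h0 h1 c e)
  rw [Real.log_mul (bitProb_pos h0 h1 c e.1).ne' (Real.exp_pos _).ne', Real.log_exp,
    Real.log_one] at hf
  have hb := bitProb_pos h0 h1 c e.1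
  have hl := noisyBit_pos h0 h1 c e.1.1 e.1.2.1 e.2
  have hN' : (0 : ℝ) < N := by positivity
  have hd' : (0 : ℝ) < d := by positivity
  rw [exampleProb_eq, predictiveProb, Real.log_mul (by positivity) hl.ne',
    Real.log_mul (by positivity) hb.ne', Real.log_mul (by positivity) (by positivity),
    one_div, one_div, Real.log_inv, Real.log_inv, labelCost]
  linarith

theorem labelCost_le {δ : ℝ} (h0 : 0 < δ) (h1 : δ < 1) (c : Instance N d) (e : Example N d) :
    labelCost δ c e ≤ -Real.log (δ / 2) :=
  neg_le_neg (Real.log_le_log (by linarith) (le_noisyBit h1 _ _ _ _))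

theorem sum_singletonIndices_add_const_le (x : Dataset N n d) (g : Example N d → ℝ) {K : ℝ}
    (hK : 0 ≤ K) : ∑ i ∈ singletonIndices x, (g (x i) + K) ≤
      ∑ i ∈ singletonIndices x, g (x i) + n * K := by
  rw [Finset.sum_add_distrib, Finset.sum_const, nsmul_eq_mul]
  have : ((singletonIndices x).card : ℝ) ≤ n := by exact_mod_cast card_singletonIndices_le x
  nlinarith

theorem sum_dataProb_mul_add_const {δ : ℝ} (h0 : 0 < δ) (h1 : δ < 1) (hN : 1 ≤ N) (hd : 1 ≤ d)
    (c : Instance N d) (K : ℝ) :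
    ∑ x : Dataset N n d, dataProb δ c x * (∑ i ∈ singletonIndices x, featCost δ c (x i) + K) =
      featInfo δ n c + K := by
  simp only [mul_add, Finset.sum_add_distrib, ← Finset.sum_mul, sum_dataProb h0 h1 hN hd c,
    one_mul, featInfo]

/-- Up to an error of order `n log d`, the entropy of the set of singletons is the information
content of their feature bits. The coding distribution gives a set `T` of examples a weight
proportional to `∏ e ∈ T, N * exampleProb δ c e`. -/
theorem entropy_singletonSet_le {δ : ℝ} (h0 : 0 < δ) (h1 : δ < 1) (hN : 1 ≤ N) (hd : 1 ≤ d)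
    (c : Instance N d) :
    entropy (dataProb (n := n) δ c) singletonSet * Real.log 2 ≤
      featInfo δ n c + (N + n * (Real.log d - Real.log (δ / 2))) := by
  have hpos := exampleProb_pos h0 h1 hN c
  have hN' : (0 : ℝ) < N := by positivity
  set q : Finset (Example N d) → ℝ := fun T =>
    Real.exp (-N) * ∏ e ∈ T, (N * exampleProb δ c e) with hq
  have hq0 : ∀ T, 0 < q T := fun T => mul_pos (Real.exp_pos _) <|
    Finset.prod_pos fun e _ => mul_pos hN' (hpos e)
  have hq1 : ∑ T, q T ≤ 1 := by
    rw [← Finset.mul_sum, ← Finset.powerset_univ, ← Finset.prod_one_add]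
    have := Real.prod_one_add_le_exp_sum Finset.univ
      (f := fun e => N * exampleProb δ c e) fun e => (mul_pos hN' (hpos e)).le
    rw [← Finset.mul_sum, sum_exampleProb h0 h1 hN hd, mul_one] at this
    calc _ ≤ Real.exp (-N) * Real.exp N := mul_le_mul_of_nonneg_left this (Real.exp_pos _).le
      _ = 1 := by rw [← Real.exp_add, neg_add_cancel, Real.exp_zero]
  refine (entropy_mul_log_two_le (fun x => (dataProb_pos h0 h1 hN c x).le)
    (sum_dataProb h0 h1 hN hd c) _ hq0 hq1).trans ?_
  rw [← sum_dataProb_mul_add_const h0 h1 hN hd]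
  refine Finset.sum_le_sum fun x _ =>
    mul_le_mul_of_nonneg_left ?_ (dataProb_pos h0 h1 hN c x).le
  have hinj : Set.InjOn x (singletonIndices x : Set (Fin n)) := fun i hi i' hi' h =>
    id_injOn_singletonIndices x hi hi' (congrArg Example.id h)
  have hK : 0 ≤ Real.log d - Real.log (δ / 2) := sub_nonneg.2 <|
    (Real.log_nonpos (by linarith) (by linarith)).trans
      (Real.log_nonneg (by exact_mod_cast hd))
  have hlog : -Real.log (q (singletonSet x)) = N + ∑ i ∈ singletonIndices x,
      (Real.log d + featCost δ c (x i) + labelCost δ c (x i)) := by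
    rw [hq, Real.log_mul (Real.exp_pos _).ne'
      (Finset.prod_pos fun e _ => mul_pos hN' (hpos e)).ne', Real.log_exp,
      Real.log_prod fun e _ => (mul_pos hN' (hpos e)).ne', singletonSet,
      Finset.sum_image hinj, neg_add, neg_neg, ← Finset.sum_neg_distrib]
    congr 1
    refine Finset.sum_congr rfl fun i _ => ?_
    rw [Real.log_mul hN'.ne' (hpos _).ne']
    linarith [neg_log_exampleProb h0 h1 hN c (x i)]
  rw [hlog]
  have := sum_singletonIndices_add_const_le x (featCost δ c) hK
  have h2 : ∑ i ∈ singletonIndices x, (Real.log d + featCost δ c (x i) + labelCost δ c (x i)) ≤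
      ∑ i ∈ singletonIndices x, (featCost δ c (x i) + (Real.log d - Real.log (δ / 2))) :=
    Finset.sum_le_sum fun i _ => by linarith [labelCost_le h0 h1 c (x i)]
  linarith

/-- Recording the positions of the singletons adds at most `n log N` to the error in
`entropy_singletonSet_le`. -/
theorem entropy_singletonFamily_le {δ : ℝ} (h0 : 0 < δ) (h1 : δ < 1) (hN : 1 ≤ N) (hd : 1 ≤ d)
    (c : Instance N d) :
    entropy (dataProb (n := n) δ c) singletonFamily * Real.log 2 ≤
      featInfo δ n c +
        (n * Real.log 2 + n * (Real.log N + Real.log d - Real.log (δ / 2))) := by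
  have hpos := exampleProb_pos h0 h1 hN c
  set r : Option (Example N d) → ℝ := fun o => 1 / 2 * o.elim 1 (exampleProb δ c) with hr
  have hr0 : ∀ o, 0 < r o := by
    rintro (_ | e)
    · simp [hr]
    · have := hpos e
      simp only [hr, Option.elim]; positivity
  have hr1 : ∑ o, r o = 1 := by
    rw [hr, ← Finset.mul_sum, Fintype.sum_option]
    simp only [Option.elim]
    rw [sum_exampleProb h0 h1 hN hd]; norm_num
  set q : (Fin n → Option (Example N d)) → ℝ := fun u => ∏ i, r (u i) with hq
  have hq0 : ∀ u, 0 < q u := fun u => Finset.prod_pos fun i _ => hr0 _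
  have hq1 : ∑ u, q u ≤ 1 := by
    have := Finset.prod_univ_sum (fun _ : Fin n => (Finset.univ : Finset (Option (Example N d))))
      fun _ o => r o
    rw [Fintype.piFinset_univ] at this
    rw [hq, ← this]
    simp [hr1]
  refine (entropy_mul_log_two_le (fun x => (dataProb_pos h0 h1 hN c x).le)
    (sum_dataProb h0 h1 hN hd c) _ hq0 hq1).trans ?_
  rw [← sum_dataProb_mul_add_const h0 h1 hN hd]
  refine Finset.sum_le_sum fun x _ =>
    mul_le_mul_of_nonneg_left ?_ (dataProb_pos h0 h1 hN c x).le
  have hK : 0 ≤ Real.log N + Real.log d - Real.log (δ / 2) := by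
    have := Real.log_nonpos (x := δ / 2) (by linarith) (by linarith)
    have := Real.log_nonneg (x := d) (by exact_mod_cast hd)
    have := Real.log_nonneg (x := N) (by exact_mod_cast hN)
    linarith
  have hlog : -Real.log (q (singletonFamily x)) = n * Real.log 2 + ∑ i ∈ singletonIndices x,
      (Real.log N + Real.log d + featCost δ c (x i) + labelCost δ c (x i)) := by
    rw [hq, Real.log_prod fun i _ => (hr0 _).ne', ← Finset.sum_neg_distrib]
    have hterm : ∀ i, -Real.log (r (singletonFamily x i)) = Real.log 2 +
        if i ∈ singletonIndices x then
          Real.log N + Real.log d + featCost δ c (x i) + labelCost δ c (x i) else 0 := by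
      intro i
      simp only [singletonFamily, hr]
      split_ifs
      · rw [Option.elim, Real.log_mul (by norm_num) (hpos _).ne', neg_add,
          neg_log_exampleProb h0 h1 hN, one_div, Real.log_inv, neg_neg]
      · simp
    simp only [hterm]
    rw [Finset.sum_add_distrib, Finset.sum_ite_mem, Finset.univ_inter]
    simp
  rw [hlog]
  have := sum_singletonIndices_add_const_le x (featCost δ c) hK
  have h2 : ∑ i ∈ singletonIndices x,
      (Real.log N + Real.log d + featCost δ c (x i) + labelCost δ c (x i)) ≤
      ∑ i ∈ singletonIndices x,
        (featCost δ c (x i) + (Real.log N + Real.log d - Real.log (δ / 2))) :=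
    Finset.sum_le_sum fun i _ => by linarith [labelCost_le h0 h1 c (x i)]
  linarith

/-! ### Lower bounds on the entropy of the singletons -/

open Classical in
/-- Bit `k` of the string of subpopulation `j`, read off from the feature vectors in `T`. It is
only meaningful when exactly one element of `T` belongs to `j` and its string is long enough. -/
def readBit (T : Finset (Example N d)) (j : Fin N) (k : Fin d) : Bool :=
  decide (∃ e ∈ T, e.id = j ∧ ∃ h : (k : ℕ) < e.1.2.1, e.1.2.2 ⟨k, h⟩ = true)

open Classical in
/-- The label of subpopulation `j`, read off from the examples in `T`. -/
def readLabel (T : Finset (Example N d)) (j : Fin N) : Bool :=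
  decide (∃ e ∈ T, e.id = j ∧ e.2 = true)

theorem eq_of_mem_singletonSet {x : Dataset N n d} {i : Fin n} (hi : i ∈ singletonIndices x)
    {e : Example N d} (he : e ∈ singletonSet x) (hid : e.id = (x i).id) : e = x i := by
  obtain ⟨i', -, rfl⟩ := Finset.mem_image.1 he
  rw [mem_singletonIndices.1 hi i' hid]

theorem mem_singletonSet {x : Dataset N n d} {i : Fin n} (hi : i ∈ singletonIndices x) :
    x i ∈ singletonSet x := Finset.mem_image_of_mem x hi

theorem readBit_singletonSet {x : Dataset N n d} {i : Fin n} (hi : i ∈ singletonIndices x)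
    (k : Fin ((x i).1.2.1 : ℕ)) :
    readBit (singletonSet x) (x i).1.1 (pos k) = (x i).1.2.2 k := by
  rw [readBit, Bool.eq_iff_iff, decide_eq_true_iff]
  constructor
  · rintro ⟨e, he, hid, h, hb⟩
    obtain rfl := eq_of_mem_singletonSet hi he hid
    exact hb
  · exact fun h => ⟨x i, mem_singletonSet hi, rfl, k.isLt, h⟩

theorem readLabel_singletonSet {x : Dataset N n d} {i : Fin n} (hi : i ∈ singletonIndices x) :
    readLabel (singletonSet x) (x i).1.1 = (x i).2 := by
  rw [readLabel, Bool.eq_iff_iff, decide_eq_true_iff]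
  constructor
  · rintro ⟨e, he, hid, hb⟩
    obtain rfl := eq_of_mem_singletonSet hi he hid
    exact hb
  · exact fun h => ⟨x i, mem_singletonSet hi, rfl, h⟩

theorem isBitLaw_ite (f : Fin N → Fin d → Bool) :
    IsBitLaw fun j k b => if b = f j k then (1 : ℝ) else 0 where
  nonneg _ _ _ := by split_ifs <;> simp
  sum_eq _ _ := by simp

/-- Any variable that determines the set of singletons has at least the entropy of the noise in
the singletons. -/
theorem le_entropy_of_determines {β : Type*} {δ : ℝ} (h0 : 0 < δ) (h1 : δ < 1) (hN : 1 ≤ N)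
    (hd : 1 ≤ d) (c : Instance N d) (f : Dataset N n d → β) (g : β → Finset (Example N d))
    (hg : ∀ x, g (f x) = singletonSet x) :
    ∑ x : Dataset N n d, dataProb δ c x *
      ∑ i ∈ singletonIndices x, (featCost δ c (x i) + labelCost δ c (x i)) ≤
      entropy (dataProb δ c) f * Real.log 2 := by
  set w : β → Fin N → Fin d → Bool → ℝ := fun u j k b =>
    if b = readBit (g u) j k then 1 else 0 with hw
  set v : β → Fin N → Fin d → Bool → ℝ := fun u j _ b =>
    if b = readLabel (g u) j then 1 else 0 with hv
  have hwl : ∀ u, IsBitLaw (w u) := fun u => isBitLaw_ite _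
  have hvl : ∀ u, IsBitLaw (v u) := fun u => isBitLaw_ite _
  refine le_entropy_mul_log_two (q := fun u x => reconProb δ c (w u) (v u) x)
    (fun x => (dataProb_pos h0 h1 hN c x).le) (sum_dataProb h0 h1 hN hd c) f
    (fun u x => reconProb_nonneg h0 h1 hN c (hwl u) (hvl u) x)
    (fun u => (sum_reconProb h0 h1 hN hd c (hwl u) (hvl u)).le) fun x => ?_
  refine dataProb_mul_exp_le_reconProb h0 h1 hN c
    (ψ := fun e => featCost δ c e + labelCost δ c e) fun i hi => le_of_eq ?_
  have hwi : bitProb (w (f x)) (x i).1 = 1 := Finset.prod_eq_one fun k _ => by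
    simp only [hw, hg]
    rw [readBit_singletonSet hi, if_pos rfl]
  have hvi : v (f x) (x i).1.1 (x i).1.2.1 (x i).2 = 1 := by
    simp only [hv, hg]
    rw [readLabel_singletonSet hi, if_pos rfl]
  rw [predictiveProb, hwi, hvi, exampleProb_eq, predictiveProb, Real.exp_add]
  have e1 := bitProb_mul_exp_featCost h0 h1 c (x i)
  have e2 := noisyBit_mul_exp_labelCost h0 h1 c (x i)
  linear_combination (1 / (N : ℝ)) * (1 / (d : ℝ)) *
    (noisyBit δ c (x i).1.1 (x i).1.2.1 (x i).2 * Real.exp (labelCost δ c (x i))) * e1 +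
    (1 / (N : ℝ)) * (1 / (d : ℝ)) * e2

/-- A position is a singleton with probability `(1 - 1 / N) ^ (n - 1)`, independently of the
length of its string. -/
theorem sum_dataProb_mul_sum_singletonIndices {δ : ℝ} (h0 : 0 < δ) (h1 : δ < 1) (hN : 1 ≤ N)
    (hd : 1 ≤ d) (c : Instance N d) (h : Fin d → ℝ) :
    ∑ x : Dataset N n d, dataProb δ c x * ∑ i ∈ singletonIndices x, h (x i).1.2.1 =
      n * ((1 / (d : ℝ)) * ∑ k, h k) * (1 - 1 / (N : ℝ)) ^ (n - 1) := by
  classical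
  have hb := isBitLaw_noisyBit h0 h1 c
  set G : Fin n → Fin N → Fin n → Example N d → ℝ := fun i j i' e =>
    if i' = i then (if e.id = j then h e.1.2.1 else 0) else (if e.id = j then 0 else 1) with hG
  have hprod : ∀ (x : Dataset N n d) (i : Fin n),
      ∑ j, ∏ i', G i j i' (x i') = if i ∈ singletonIndices x then h (x i).1.2.1 else 0 := by
    intro x i
    rw [Finset.sum_eq_single (x i).id]
    · split_ifs with hi
      · rw [Finset.prod_eq_single i]
        · simp [hG]
        · intro i' _ hne
          simp only [hG, if_neg hne]
          exact if_neg fun hid => hne (mem_singletonIndices.1 hi i' hid)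
        · simp
      · rw [mem_singletonIndices] at hi
        push Not at hi
        obtain ⟨i', hid, hne⟩ := hi
        exact Finset.prod_eq_zero (Finset.mem_univ i') (by simp [hG, hne, hid])
    · intro j _ hj
      exact Finset.prod_eq_zero (Finset.mem_univ i) (by simp [hG, Ne.symm hj])
    · simp
  have hx : ∀ x : Dataset N n d,
      dataProb δ c x * ∑ i ∈ singletonIndices x, h (x i).1.2.1 =
        ∑ i, ∑ j, ∏ i', exampleProb δ c (x i') * G i j i' (x i') := by
    intro x
    simp only [Finset.prod_mul_distrib, ← Finset.mul_sum, hprod]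
    rw [Finset.sum_ite_mem, Finset.univ_inter, dataProb]
  have hself : ∀ i j, ∑ e, exampleProb δ c e * G i j i e =
      1 / (N : ℝ) * ((1 / (d : ℝ)) * ∑ k, h k) := by
    intro i j
    have := sum_predictiveProb_mul hb hb fun j' k => if j' = j then h k else 0
    simp only [hG, if_pos]
    refine this.trans ?_
    rw [Finset.sum_comm]
    simp [Finset.mul_sum, mul_assoc]
  have hother : ∀ i j i', i' ≠ i → ∑ e, exampleProb δ c e * G i j i' e = 1 - 1 / (N : ℝ) := by
    intro i j i' hne
    rw [← sum_predictiveProb_id hb hb hd j, ← sum_exampleProb h0 h1 hN hd c,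
      ← Finset.sum_sub_distrib]
    refine Finset.sum_congr rfl fun e _ => ?_
    simp only [hG, if_neg hne, exampleProb_eq]
    split_ifs <;> simp
  have hN' : (N : ℝ) ≠ 0 := by positivity
  simp only [hx]
  rw [Finset.sum_comm]
  have : ∀ i : Fin n, ∑ x : Dataset N n d, ∑ j, ∏ i', exampleProb δ c (x i') * G i j i' (x i') =
      ((1 / (d : ℝ)) * ∑ k, h k) * (1 - 1 / (N : ℝ)) ^ (n - 1) := by
    intro i
    rw [Finset.sum_comm]
    have hj : ∀ j, ∑ x : Dataset N n d, ∏ i', exampleProb δ c (x i') * G i j i' (x i') =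
        1 / (N : ℝ) * (((1 / (d : ℝ)) * ∑ k, h k) * (1 - 1 / (N : ℝ)) ^ (n - 1)) := by
      intro j
      rw [sum_prod_dataset fun i' e => exampleProb δ c e * G i j i' e,
        ← Finset.mul_prod_erase _ _ (Finset.mem_univ i), hself,
        Finset.prod_congr rfl fun i' hi' => hother i j i' (Finset.ne_of_mem_erase hi')]
      simp [mul_assoc]
    simp only [hj]
    simp [hN']
  simp only [this]
  simp [mul_assoc]

theorem exp_neg_one_le_one_sub_inv_pow {n : ℕ} (hn : 1 ≤ n) :
    Real.exp (-1) ≤ (1 - 1 / (n : ℝ)) ^ (n - 1) := by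
  obtain ⟨m, rfl⟩ : ∃ m, n = m + 1 := ⟨n - 1, by omega⟩
  rcases Nat.eq_zero_or_pos m with rfl | hm
  · simp
  have hm' : (0 : ℝ) < m := by positivity
  have h1 : (1 : ℝ) - 1 / ((m + 1 : ℕ) : ℝ) = (1 + 1 / (m : ℝ))⁻¹ := by
    push_cast; field_simp; ring
  rw [h1, inv_pow, Real.exp_neg, Nat.add_sub_cancel]
  refine inv_anti₀ (by positivity) ?_
  calc (1 + 1 / (m : ℝ)) ^ m ≤ Real.exp (1 / m) ^ m := by
        gcongr
        linarith [Real.add_one_le_exp (1 / (m : ℝ))]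
    _ = Real.exp 1 := by
        rw [← Real.exp_nat_mul]; congr 1; field_simp

/-- The constant in the linear lower bound on the entropy of the singletons, in nats. -/
def entropyRate (δ : ℝ) : ℝ := -Real.log (1 - δ / 2) * Real.exp (-1) / 2

theorem entropyRate_pos {δ : ℝ} (h0 : 0 < δ) (h1 : δ < 1) : 0 < entropyRate δ := by
  have : 0 < -Real.log (1 - δ / 2) := neg_pos.2 (Real.log_neg (by linarith) (by linarith))
  have := Real.exp_pos (-1)
  unfold entropyRate
  positivity

/-- A constant fraction of the `n` examples are singletons, and their strings have average length
about `d / 2`; each of their bits carries noise. -/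
theorem entropyRate_mul_le {δ : ℝ} (h0 : 0 < δ) (h1 : δ < 1) (hn : 1 ≤ n) (hd : 1 ≤ d)
    (c : Instance n d) :
    entropyRate δ * (n * d) ≤ ∑ x : Dataset n n d, dataProb δ c x *
      ∑ i ∈ singletonIndices x, (featCost δ c (x i) + labelCost δ c (x i)) := by
  set l : ℝ := -Real.log (1 - δ / 2) with hl
  have hl0 : 0 < l := neg_pos.2 (Real.log_neg (by linarith) (by linarith))
  have hbit : ∀ j k b, l ≤ -Real.log (noisyBit δ c j k b) := fun j k b =>
    neg_le_neg (Real.log_le_log (noisyBit_pos h0 h1 c j k b) (noisyBit_le h1 c j k b))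
  have hcost : ∀ e : Example n d, ((e.1.2.1 : ℕ) + 1 : ℝ) * l ≤
      featCost δ c e + labelCost δ c e := by
    intro e
    have h1 : ((e.1.2.1 : ℕ) : ℝ) * l ≤ featCost δ c e := by
      have := Finset.sum_le_sum fun (i : Fin (e.1.2.1 : ℕ)) (_ : i ∈ Finset.univ) =>
        hbit e.1.1 (pos i) (e.1.2.2 i)
      simpa [featCost] using this
    have h2 : l ≤ labelCost δ c e := hbit _ _ _
    linarith
  have hsum := sum_dataProb_mul_sum_singletonIndices (n := n) h0 h1 hn hd c
    fun k => ((k : ℕ) + 1 : ℝ) * l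
  have hd' : (0 : ℝ) < d := by positivity
  have hgauss : ∑ k : Fin d, ((k : ℕ) + 1 : ℝ) * l = d * (d + 1) / 2 * l := by
    rw [← Finset.sum_mul, Fin.sum_univ_eq_sum_range fun k => (k + 1 : ℝ)]
    congr 1
    clear * -
    induction d with
    | zero => simp
    | succ m ih => rw [Finset.sum_range_succ, ih]; push_cast; ring
  calc entropyRate δ * (n * d) = n * ((d / 2) * l) * Real.exp (-1) := by
        rw [entropyRate, ← hl]; ring
    _ ≤ n * ((1 / (d : ℝ)) * ∑ k : Fin d, ((k : ℕ) + 1 : ℝ) * l) *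
          (1 - 1 / (n : ℝ)) ^ (n - 1) := by
        have he := exp_neg_one_le_one_sub_inv_pow hn
        have hm : d / 2 * l ≤ 1 / (d : ℝ) * ∑ k : Fin d, ((k : ℕ) + 1 : ℝ) * l := by
          rw [hgauss]
          have : 1 / (d : ℝ) * (d * (d + 1) / 2 * l) = d / 2 * l + l / 2 := by field_simp
          linarith
        gcongr
    _ = _ := hsum.symm
    _ ≤ _ := Finset.sum_le_sum fun x _ => mul_le_mul_of_nonneg_left
        (Finset.sum_le_sum fun i _ => hcost (x i)) (dataProb_pos h0 h1 hn c x).le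

theorem entropyRate_mul_le_entropy_singletonSet {δ : ℝ} (h0 : 0 < δ) (h1 : δ < 1) (hn : 1 ≤ n)
    (hd : 1 ≤ d) (c : Instance n d) :
    entropyRate δ * (n * d) ≤
      entropy (dataProb (n := n) δ c) singletonSet * Real.log 2 :=
  (entropyRate_mul_le h0 h1 hn hd c).trans
    (le_entropy_of_determines h0 h1 hn hd c _ id fun _ => rfl)

theorem entropyRate_mul_le_entropy_singletonFamily {δ : ℝ} (h0 : 0 < δ) (h1 : δ < 1)
    (hn : 1 ≤ n) (hd : 1 ≤ d) (c : Instance n d) :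
    entropyRate δ * (n * d) ≤
      entropy (dataProb (n := n) δ c) singletonFamily * Real.log 2 := by
  classical
  set g : (Fin n → Option (Example n d)) → Finset (Example n d) := fun u =>
    Finset.univ.filter fun e => ∃ i, u i = some e with hg
  refine (entropyRate_mul_le h0 h1 hn hd c).trans
    (le_entropy_of_determines h0 h1 hn hd c _ g fun x => ?_)
  ext e
  rw [hg, Finset.mem_filter_univ, singletonSet, Finset.mem_image]
  refine exists_congr fun i => ?_
  rw [singletonFamily]
  split_ifs with h <;> simp [h]

/-! ### Predictions of a model on the bits of the singletons -/

/-- The probability that the predictor `a` fails to output `b` on a random noisy prefix of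
length `k` of the reference string `c j`. -/
def missProb (δ : ℝ) (c : Instance N d) (a : Input N d → Bool → ℝ) (j : Fin N) (k : Fin d)
    (b : Bool) : ℝ :=
  ∑ z : Fin (k : ℕ) → Bool, bitProb (noisyBit δ c) (j, ⟨k, z⟩) * (1 - a (j, ⟨k, z⟩) b)

/-- The expected number of feature bits of the singletons that the predictor `a x`, obtained from
the data set `x`, fails to reproduce from fresh noisy prefixes of the reference strings. -/
def expectedMisses (δ : ℝ) (c : Instance N d) (a : Dataset N n d → Input N d → Bool → ℝ) : ℝ :=
  ∑ x : Dataset N n d, dataProb δ c x * ∑ i ∈ singletonIndices x,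
    ∑ k : Fin ((x i).1.2.1 : ℕ), missProb δ c (a x) (x i).1.1 (pos k) ((x i).1.2.2 k)

theorem missProb_mem_Icc {δ : ℝ} (h0 : 0 < δ) (h1 : δ < 1) (c : Instance N d)
    {a : Input N d → Bool → ℝ} (ha0 : ∀ z b, 0 ≤ a z b) (ha1 : ∀ z b, a z b ≤ 1) (j : Fin N)
    (k : Fin d) (b : Bool) : missProb δ c a j k b ∈ Set.Icc 0 1 := by
  refine ⟨Finset.sum_nonneg fun z _ => mul_nonneg (bitProb_pos h0 h1 c _).le
    (sub_nonneg.2 (ha1 _ _)), ?_⟩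
  rw [← (isBitLaw_noisyBit h0 h1 c).sum_bitProb j k]
  refine Finset.sum_le_sum fun z _ => mul_le_of_le_one_right (bitProb_pos h0 h1 c _).le ?_
  linarith [ha0 (j, ⟨k, z⟩) b]

theorem sum_missProb {δ : ℝ} (h0 : 0 < δ) (h1 : δ < 1) (c : Instance N d)
    {a : Input N d → Bool → ℝ} (ha : ∀ z, ∑ b, a z b = 1) (j : Fin N) (k : Fin d) :
    ∑ b, missProb δ c a j k b = 1 := by
  unfold missProb
  rw [Finset.sum_comm]
  simp only [← Finset.mul_sum, Finset.sum_sub_distrib, ha]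
  simp only [Finset.sum_const, Finset.card_univ, Fintype.card_bool, nsmul_eq_mul]
  norm_num
  exact (isBitLaw_noisyBit h0 h1 c).sum_bitProb j k

/-- The probability that a model output on the data set `x` predicts `b` on input `z`. -/
def predProb (A : Learner.{u} N n d) (x : Dataset N n d) (z : Input N d) (b : Bool) : ℝ :=
  ∫ m, (A.predict z m).real {b} ∂A.train x

attribute [instance] Learner.train_prob Learner.predict_markov

theorem measurable_predict_real (A : Learner.{u} N n d) (z : Input N d) (b : Bool) :
    Measurable fun m => (A.predict z m).real {b} :=
  ((A.predict z).measurable_coe (measurableSet_singleton b)).ennreal_toReal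

theorem integrable_predict_real (A : Learner.{u} N n d) (x : Dataset N n d) (z : Input N d)
    (b : Bool) : Integrable (fun m => (A.predict z m).real {b}) (A.train x) :=
  Integrable.of_bound (measurable_predict_real A z b).aestronglyMeasurable 1
    (Eventually.of_forall fun m => by
      rw [Real.norm_eq_abs, abs_of_nonneg measureReal_nonneg]; exact measureReal_le_one)

theorem sum_real_singleton_bool (μ : Measure Bool) [IsProbabilityMeasure μ] :
    ∑ b, μ.real {b} = 1 := by
  rw [sum_measureReal_singleton, Finset.coe_univ, probReal_univ]

theorem predProb_nonneg (A : Learner.{u} N n d) (x : Dataset N n d) (z : Input N d)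
    (b : Bool) : 0 ≤ predProb A x z b := integral_nonneg fun _ => measureReal_nonneg

theorem sum_predProb (A : Learner.{u} N n d) (x : Dataset N n d) (z : Input N d) :
    ∑ b, predProb A x z b = 1 := by
  unfold predProb
  rw [← integral_finsetSum _ fun b _ => integrable_predict_real A x z b]
  simp only [sum_real_singleton_bool]
  simp

/-- The logarithmic loss of a prediction smoothed by `t` is at most linear in the probability `s`
of a wrong prediction. -/
theorem exp_log_add_mul_log_le {t s : ℝ} (ht0 : 0 < t) (ht1 : t < 1 / 2) (hs : s ∈ Set.Icc 0 1) :
    Real.exp (Real.log (1 - t) + s * Real.log t) ≤ t + (1 - 2 * t) * (1 - s) := by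
  have h := Real.geom_mean_le_arith_mean2_weighted (sub_nonneg.2 hs.2) hs.1
    (by linarith : 0 ≤ 1 - t) ht0.le (by ring)
  rw [Real.rpow_def_of_pos (by linarith), Real.rpow_def_of_pos ht0, ← Real.exp_add] at h
  have hl : Real.log (1 - t) ≤ 0 := Real.log_nonpos (by linarith) (by linarith)
  calc _ ≤ Real.exp (Real.log (1 - t) * (1 - s) + Real.log t * s) := by
        apply Real.exp_le_exp.2
        nlinarith [hs.1]
    _ ≤ _ := h
    _ = _ := by ring

/-- A model that predicts the bits of the singletons with few misses holds nearly all of their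
information. -/
theorem le_mutualInfo_train {δ : ℝ} (h0 : 0 < δ) (h1 : δ < 1) (hN : 1 ≤ N) (hd : 1 ≤ d)
    (c : Instance N d) (A : Learner.{u} N n d) {t : ℝ} (ht0 : 0 < t) (ht1 : t < 1 / 2) :
    featInfo δ n c + (n * d * Real.log (1 - t) +
      Real.log t * expectedMisses δ c (predProb A)) ≤
      mutualInfo (dataProb (n := n) δ c) A.train * Real.log 2 := by
  -- The reconstruction reads off the bits of the singletons from the predictions of the model,
  -- smoothed by `t` to keep the logarithmic loss finite.
  set a : A.Model → Input N d → Bool → ℝ := fun m z b => (A.predict z m).real {b} with ha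
  have ha0 : ∀ m z b, 0 ≤ a m z b := fun _ _ _ => measureReal_nonneg
  have ha1 : ∀ m z b, a m z b ≤ 1 := fun _ _ _ => measureReal_le_one
  have hmiss : ∀ m j k b, missProb δ c (a m) j k b ∈ Set.Icc 0 1 := fun m =>
    missProb_mem_Icc h0 h1 c (ha0 m) (ha1 m)
  set w : A.Model → Fin N → Fin d → Bool → ℝ := fun m j k b =>
    t + (1 - 2 * t) * (1 - missProb δ c (a m) j k b) with hw
  have hwl : ∀ m, IsBitLaw (w m) := by
    refine fun m => ⟨fun j k b => ?_, fun j k => ?_⟩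
    · have := hmiss m j k b
      have := mul_nonneg (by linarith : 0 ≤ 1 - 2 * t) (sub_nonneg.2 this.2)
      simp only [hw]; linarith
    · have := sum_missProb h0 h1 c (a := a m) (fun z => sum_real_singleton_bool _) j k
      rw [Fintype.sum_bool] at this ⊢
      simp only [hw]
      linear_combination (-(1 - 2 * t)) * this
  set ψ : A.Model → Example N d → ℝ := fun m e => featCost δ c e +
    ∑ k : Fin (e.1.2.1 : ℕ), (Real.log (1 - t) +
      missProb δ c (a m) e.1.1 (pos k) (e.1.2.2 k) * Real.log t) with hψ
  have hmeas : ∀ j k b, Measurable fun m => missProb δ c (a m) j k b := fun j k b =>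
    Finset.measurable_sum _ fun z _ =>
      ((measurable_predict_real A _ b).const_sub 1).const_mul _
  have hψmeas : ∀ e, Measurable fun m => ψ m e := fun e =>
    (Finset.measurable_sum _ fun k _ => ((hmeas _ _ _).mul_const _).const_add _).const_add _
  have hψbdd : ∀ e m, |ψ m e| ≤ |featCost δ c e| +
      ∑ k : Fin (e.1.2.1 : ℕ), (|Real.log (1 - t)| + |Real.log t|) := by
    intro e m
    refine (abs_add_le _ _).trans (add_le_add_right ((Finset.abs_sum_le_sum_abs _ _).trans
      (Finset.sum_le_sum fun k _ => (abs_add_le _ _).trans (add_le_add_right ?_ _))) _)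
    have := hmiss m e.1.1 (pos k) (e.1.2.2 k)
    rw [abs_mul, abs_of_nonneg this.1]
    exact mul_le_of_le_one_left (abs_nonneg _) this.2
  have hψint : ∀ e x, Integrable (fun m => ψ m e) (A.train x) := fun e x =>
    Integrable.of_bound (hψmeas e).aestronglyMeasurable _ (Eventually.of_forall (hψbdd e))
  have hexample : ∀ m e, exampleProb δ c e * Real.exp (ψ m e) ≤
      predictiveProb (w m) (noisyBit δ c) e := by
    intro m e
    have hprod : Real.exp (∑ k : Fin (e.1.2.1 : ℕ), (Real.log (1 - t) +
        missProb δ c (a m) e.1.1 (pos k) (e.1.2.2 k) * Real.log t)) ≤ bitProb (w m) e.1 := by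
      rw [Real.exp_sum]
      exact Finset.prod_le_prod (fun _ _ => (Real.exp_pos _).le) fun k _ =>
        exp_log_add_mul_log_le ht0 ht1 (hmiss _ _ _ _)
    have hf := bitProb_mul_exp_featCost h0 h1 c e
    have hl := (noisyBit_pos h0 h1 c e.1.1 e.1.2.1 e.2).le
    have hK : 0 ≤ (1 / (N : ℝ)) * (1 / (d : ℝ)) := by positivity
    rw [exampleProb_eq, predictiveProb, predictiveProb]
    simp only [hψ]
    rw [Real.exp_add]
    calc _ = (1 / (N : ℝ)) * (1 / (d : ℝ)) *
          Real.exp (∑ k : Fin (e.1.2.1 : ℕ), (Real.log (1 - t) +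
            missProb δ c (a m) e.1.1 (pos k) (e.1.2.2 k) * Real.log t)) *
          noisyBit δ c e.1.1 e.1.2.1 e.2 *
          (bitProb (noisyBit δ c) e.1 * Real.exp (featCost δ c e)) := by ring
      _ ≤ _ := by
          rw [hf, mul_one]
          gcongr
  have key := le_mutualInfo (dataProb_pos h0 h1 hN c) (sum_dataProb h0 h1 hN hd c) A.train
    (φ := fun x m => ∑ i ∈ singletonIndices x, ψ m (x i))
    (fun x => Finset.measurable_sum _ fun i _ => hψmeas _)
    (fun x => ⟨_, fun m => (Finset.abs_sum_le_sum_abs _ _).trans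
      (Finset.sum_le_sum fun i _ => hψbdd _ m)⟩)
    (fun m => by
      rw [← sum_reconProb (n := n) h0 h1 hN hd c (hwl m) (isBitLaw_noisyBit h0 h1 c)]
      exact Finset.sum_le_sum fun x _ =>
        dataProb_mul_exp_le_reconProb h0 h1 hN c fun i _ => hexample m (x i))
  refine le_trans ?_ key
  have hmissint : ∀ x j k b, ∫ m, missProb δ c (a m) j k b ∂A.train x =
      missProb δ c (predProb A x) j k b := by
    intro x j k b
    unfold missProb
    have hI : ∀ z, Integrable (fun m => 1 - a m z b) (A.train x) := fun z =>
      (integrable_const _).sub (integrable_predict_real A x z b)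
    rw [integral_finsetSum _ fun z _ => (hI _).const_mul _]
    refine Finset.sum_congr rfl fun z _ => ?_
    rw [integral_const_mul, integral_sub (integrable_const _) (integrable_predict_real A x _ b)]
    simp [predProb]
  have hmissI : ∀ x j k b, Integrable (fun m => missProb δ c (a m) j k b) (A.train x) :=
    fun x j k b => Integrable.of_bound (hmeas j k b).aestronglyMeasurable 1
      (Eventually.of_forall fun m => by
        rw [Real.norm_eq_abs, abs_of_nonneg (hmiss m j k b).1]; exact (hmiss m j k b).2)
  have hint : ∀ x e, ∫ m, ψ m e ∂A.train x = featCost δ c e +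
      ∑ k : Fin (e.1.2.1 : ℕ), (Real.log (1 - t) +
        missProb δ c (predProb A x) e.1.1 (pos k) (e.1.2.2 k) * Real.log t) := by
    intro x e
    have hI : ∀ k : Fin (e.1.2.1 : ℕ), Integrable (fun m => Real.log (1 - t) +
        missProb δ c (a m) e.1.1 (pos k) (e.1.2.2 k) * Real.log t) (A.train x) :=
      fun k => (integrable_const _).add ((hmissI _ _ _ _).mul_const _)
    simp only [hψ]
    rw [integral_add (integrable_const _) (integrable_finsetSum _ fun k _ => hI k),
      integral_finsetSum _ fun k _ => hI k]
    congr 1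
    · simp
    refine Finset.sum_congr rfl fun k _ => ?_
    rw [integral_add (integrable_const _) ((hmissI _ _ _ _).mul_const _), integral_mul_const,
      hmissint]
    simp
  have hlt : Real.log (1 - t) ≤ 0 := Real.log_nonpos (by linarith) (by linarith)
  have hx : ∀ x : Dataset N n d, ∑ i ∈ singletonIndices x, featCost δ c (x i) +
      (n * d * Real.log (1 - t) + Real.log t * ∑ i ∈ singletonIndices x,
        ∑ k : Fin ((x i).1.2.1 : ℕ),
          missProb δ c (predProb A x) (x i).1.1 (pos k) ((x i).1.2.2 k)) ≤
      ∫ m, ∑ i ∈ singletonIndices x, ψ m (x i) ∂A.train x := by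
    intro x
    rw [integral_finsetSum _ fun i _ => hψint _ x]
    simp only [hint, Finset.sum_add_distrib, ← Finset.sum_mul]
    have hcount : n * d * Real.log (1 - t) ≤ ∑ i ∈ singletonIndices x,
        ∑ _k : Fin ((x i).1.2.1 : ℕ), Real.log (1 - t) := by
      have h2 : ∑ i ∈ singletonIndices x, ((x i).1.2.1 : ℕ) ≤ n * d :=
        (Finset.sum_le_card_nsmul _ _ d fun i _ => (x i).1.2.1.isLt.le).trans
          (by rw [smul_eq_mul]; exact Nat.mul_le_mul_right _ (card_singletonIndices_le x))
      have h3 : (∑ i ∈ singletonIndices x, ((x i).1.2.1 : ℕ) : ℝ) ≤ n * d := by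
        exact_mod_cast h2
      simp only [Finset.sum_const, Finset.card_univ, Fintype.card_fin, nsmul_eq_mul]
      rw [← Finset.sum_mul]
      exact mul_le_mul_of_nonpos_right h3 hlt
    linarith
  calc _ = ∑ x : Dataset N n d, dataProb δ c x * (∑ i ∈ singletonIndices x, featCost δ c (x i) +
      (n * d * Real.log (1 - t) + Real.log t * ∑ i ∈ singletonIndices x,
        ∑ k : Fin ((x i).1.2.1 : ℕ),
          missProb δ c (predProb A x) (x i).1.1 (pos k) ((x i).1.2.2 k))) := by
        simp only [mul_add, Finset.sum_add_distrib, ← Finset.sum_mul,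
          sum_dataProb h0 h1 hN hd c, one_mul, featInfo, expectedMisses, Finset.mul_sum,
          mul_left_comm (Real.log t)]
    _ ≤ _ := Finset.sum_le_sum fun x _ =>
        mul_le_mul_of_nonneg_left (hx x) (dataProb_pos h0 h1 hN c x).le

/-! ### The excess error of a learner -/

/-- The error, given the instance `c`, of a learner with mean predictions `a`. -/
def predErr (δ : ℝ) (c : Instance N d) (a : Dataset N n d → Input N d → Bool → ℝ) : ℝ :=
  ∑ x, dataProb δ c x * ∑ e : Example N d, exampleProb δ c e * (1 - a x e.1 e.2)

theorem err_eq (δ : ℝ) (A : Learner.{u} N n d) :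
    err δ A = expInstance fun c => predErr δ c (predProb A) := by
  unfold err predErr
  congr 1
  ext c
  refine Finset.sum_congr rfl fun x _ => congrArg _ (Finset.sum_congr rfl fun e _ => ?_)
  congr 1
  have : ∀ m, (A.predict e.1 m).real {y | y ≠ e.2} = 1 - (A.predict e.1 m).real {e.2} := by
    intro m
    rw [← probReal_compl_eq_one_sub (measurableSet_singleton _)]
    rfl
  simp only [this]
  rw [integral_sub (integrable_const _) (integrable_predict_real A x _ _)]
  simp [predProb]

theorem err_nonneg {δ : ℝ} (h0 : 0 < δ) (h1 : δ < 1) (hN : 1 ≤ N) (A : Learner.{u} N n d) :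
    0 ≤ err δ A := by
  refine div_nonneg (Finset.sum_nonneg fun c _ => Finset.sum_nonneg fun x _ =>
    mul_nonneg (dataProb_pos h0 h1 hN c x).le (Finset.sum_nonneg fun e _ =>
      mul_nonneg (exampleProb_pos h0 h1 hN c e).le (integral_nonneg fun _ => ?_)))
    (Nat.cast_nonneg _)
  exact measureReal_nonneg

/-- The law on `Bool` with point masses `p`. -/
def boolLaw (p : Bool → ℝ) : Measure Bool := ∑ b, ENNReal.ofReal (p b) • Measure.dirac b

theorem isProbabilityMeasure_boolLaw {p : Bool → ℝ} (h0 : ∀ b, 0 ≤ p b) (h1 : ∑ b, p b = 1) :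
    IsProbabilityMeasure (boolLaw p) := ⟨by
  simp only [boolLaw, Measure.finsetSum_apply, Measure.smul_apply, measure_univ, smul_eq_mul,
    mul_one]
  rw [← ENNReal.ofReal_sum_of_nonneg fun b _ => h0 b, h1, ENNReal.ofReal_one]⟩

theorem boolLaw_real_singleton {p : Bool → ℝ} (h0 : ∀ b, 0 ≤ p b) (b : Bool) :
    (boolLaw p).real {b} = p b := by
  rw [measureReal_def, boolLaw, Measure.finsetSum_apply, Finset.sum_eq_single b]
  · simp [h0 b]
  · intro b' _ hb'
    simp [hb']
  · simp

/-- Every table of predictions is realized by a learner, whose model is the data set itself. -/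
theorem exists_learner (a : Dataset N n d → Input N d → Bool → ℝ) (h0 : ∀ x z b, 0 ≤ a x z b)
    (h1 : ∀ x z, ∑ b, a x z b = 1) : ∃ A : Learner.{u} N n d, predProb A = a := by
  let _ : MeasurableSpace (ULift.{u} (Dataset N n d)) := ⊤
  refine ⟨{ Model := ULift.{u} (Dataset N n d)
            train := fun x => Measure.dirac ⟨x⟩
            train_prob := fun _ => inferInstance
            predict := fun z => ⟨fun m => boolLaw (a m.down z), measurable_from_top⟩
            predict_markov := fun z => ⟨fun m =>
              isProbabilityMeasure_boolLaw (h0 m.down z) (h1 m.down z)⟩ }, ?_⟩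
  ext x z b
  unfold predProb
  refine (integral_dirac' _ _ measurable_from_top.stronglyMeasurable).trans ?_
  exact boolLaw_real_singleton (h0 x z) b

theorem IsSuboptimal.err_le {δ ε : ℝ} (h0 : 0 < δ) (h1 : δ < 1) (hN : 1 ≤ N)
    {A : Learner.{u} N n d} (hA : IsSuboptimal δ ε A) (A' : Learner.{u} N n d) :
    err δ A ≤ err δ A' + ε :=
  hA.trans (add_le_add_left (ciInf_le ⟨0, by rintro _ ⟨A', rfl⟩; exact err_nonneg h0 h1 hN A'⟩ A')
    ε)

/-! ### Comparison with a learner that repeats the stored bits -/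

/-- The data contain bit `k` of a noisy copy of the string of subpopulation `j` as a feature of an
element of `T`. -/
def IsKnown (T : Finset (Example N d)) (j : Fin N) (k : Fin d) : Prop :=
  ∃ e ∈ T, e.id = j ∧ (k : ℕ) < e.1.2.1

open Classical in
/-- The predictions `a`, modified so that every bit that occurs in the features of a singleton is
predicted by its value there. -/
def repeatStored (a : Dataset N n d → Input N d → Bool → ℝ) (x : Dataset N n d) (z : Input N d)
    (b : Bool) : ℝ :=
  if IsKnown (singletonSet x) z.1 z.2.1 then
    if b = readBit (singletonSet x) z.1 z.2.1 then 1 else 0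
  else a x z b

/-- Flips bit `k` of the reference string of subpopulation `j`. -/
def flipBit (j : Fin N) (k : Fin d) (c : Instance N d) : Instance N d :=
  Function.update c j (Function.update (c j) k (!c j k))

theorem flipBit_flipBit (j : Fin N) (k : Fin d) (c : Instance N d) :
    flipBit j k (flipBit j k c) = c := by
  simp [flipBit]

theorem flipBit_self (j : Fin N) (k : Fin d) (c : Instance N d) :
    flipBit j k c j k = !c j k := by
  simp [flipBit]

theorem flipBit_of_ne {j j' : Fin N} {k k' : Fin d} (h : ¬ (j' = j ∧ k' = k))
    (c : Instance N d) : flipBit j k c j' k' = c j' k' := by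
  unfold flipBit
  by_cases hj : j' = j
  · subst hj
    simp only [Function.update_self]
    exact Function.update_of_ne (fun hk => h ⟨rfl, hk⟩) _ _
  · rw [Function.update_of_ne hj]

theorem noisyBit_flipBit_of_ne (δ : ℝ) {j j' : Fin N} {k k' : Fin d} (h : ¬ (j' = j ∧ k' = k))
    (c : Instance N d) : noisyBit δ (flipBit j k c) j' k' = noisyBit δ c j' k' := by
  simp only [noisyBit, flipBit_of_ne h]

theorem bitProb_flipBit_of_le (δ : ℝ) {j : Fin N} {k : Fin d} (c : Instance N d)
    {z : Input N d} (h : z.1 = j → z.2.1 ≤ k) :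
    bitProb (noisyBit δ (flipBit j k c)) z = bitProb (noisyBit δ c) z := by
  refine Finset.prod_congr rfl fun i _ => ?_
  rw [noisyBit_flipBit_of_ne]
  rintro ⟨hj, hk⟩
  have h2 : (i : ℕ) = k := congrArg Fin.val hk
  have h3 : (z.2.1 : ℕ) ≤ k := h hj
  omega

/-- If bit `k` of the string of a singleton is a feature, then the probability of the data depends
on the corresponding reference bit only through the noise on that feature. -/
theorem dataProb_flipBit (δ : ℝ) (c : Instance N d) {x : Dataset N n d} {i : Fin n}
    (hi : i ∈ singletonIndices x) (k : Fin ((x i).1.2.1 : ℕ)) :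
    dataProb δ c x * noisyBit δ (flipBit (x i).1.1 (pos k) c) (x i).1.1 (pos k) ((x i).1.2.2 k) =
      dataProb δ (flipBit (x i).1.1 (pos k) c) x *
        noisyBit δ c (x i).1.1 (pos k) ((x i).1.2.2 k) := by
  set c' := flipBit (x i).1.1 (pos k) c with hc'
  have hrest : ∏ i' ∈ Finset.univ.erase i, exampleProb δ c' (x i') =
      ∏ i' ∈ Finset.univ.erase i, exampleProb δ c (x i') := by
    refine Finset.prod_congr rfl fun i' hi' => ?_
    have hne : (x i').1.1 ≠ (x i).1.1 := fun h =>
      Finset.ne_of_mem_erase hi' (mem_singletonIndices.1 hi i' h)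
    rw [exampleProb_eq, exampleProb_eq, predictiveProb, predictiveProb,
      bitProb_flipBit_of_le δ c fun h => absurd h hne,
      noisyBit_flipBit_of_ne δ fun h => hne h.1]
  have hlabel : noisyBit δ c' (x i).1.1 (x i).1.2.1 = noisyBit δ c (x i).1.1 (x i).1.2.1 := by
    refine noisyBit_flipBit_of_ne δ ?_ c
    rintro ⟨-, h⟩
    have h2 : ((x i).1.2.1 : ℕ) = k := congrArg Fin.val h
    have := k.isLt
    omega
  have hbits : ∏ k' ∈ Finset.univ.erase k, noisyBit δ c' (x i).1.1 (pos k') ((x i).1.2.2 k') =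
      ∏ k' ∈ Finset.univ.erase k, noisyBit δ c (x i).1.1 (pos k') ((x i).1.2.2 k') := by
    refine Finset.prod_congr rfl fun k' hk' => ?_
    rw [noisyBit_flipBit_of_ne]
    rintro ⟨-, h⟩
    exact Finset.ne_of_mem_erase hk' (Fin.ext (congrArg (Fin.val (n := d)) h))
  unfold dataProb
  rw [← Finset.mul_prod_erase _ _ (Finset.mem_univ i),
    ← Finset.mul_prod_erase _ (fun i' => exampleProb δ c' (x i')) (Finset.mem_univ i), hrest,
    exampleProb_eq, exampleProb_eq, predictiveProb, predictiveProb, bitProb, bitProb, hlabel,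
    ← Finset.mul_prod_erase _ _ (Finset.mem_univ k),
    ← Finset.mul_prod_erase _ (fun k' => noisyBit δ c' (x i).1.1 (pos k') ((x i).1.2.2 k'))
      (Finset.mem_univ k), hbits]
  ring

/-- Posterior advantage of the stored bit: given the data and a test prefix, the next bit of a test
string agrees with the bit stored in a singleton with a margin of `(1 - δ) ^ 2`. -/
theorem sum_dataProb_mul_sub (δ : ℝ) {x : Dataset N n d} {i : Fin n}
    (hi : i ∈ singletonIndices x) (k : Fin ((x i).1.2.1 : ℕ))
    (z : Fin ((pos k : Fin d) : ℕ) → Bool) :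
    ∑ c : Instance N d, dataProb δ c x * bitProb (noisyBit δ c) ((x i).1.1, ⟨pos k, z⟩) *
      (noisyBit δ c (x i).1.1 (pos k) ((x i).1.2.2 k) -
        noisyBit δ c (x i).1.1 (pos k) (!(x i).1.2.2 k)) =
    (1 - δ) ^ 2 * ∑ c : Instance N d,
      dataProb δ c x * bitProb (noisyBit δ c) ((x i).1.1, ⟨pos k, z⟩) := by
  set j := (x i).1.1 with hj
  set y := (x i).1.2.2 k with hy
  set W : Instance N d → ℝ := fun c =>
    dataProb δ c x * bitProb (noisyBit δ c) (j, ⟨pos k, z⟩) with hW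
  set h : Instance N d → ℝ := fun c => W c *
    (noisyBit δ c j (pos k) y - noisyBit δ c j (pos k) (!y) - (1 - δ) ^ 2) with hh
  -- The contributions of two instances that differ only in the bit in question cancel.
  have hpair : ∀ c, h (flipBit j (pos k) c) = - h c := by
    intro c
    have h1 := dataProb_flipBit δ c hi k
    have h2 := bitProb_flipBit_of_le δ (j := j) (k := pos k) c (z := (j, ⟨pos k, z⟩))
      fun _ => le_rfl
    rw [← hj, ← hy] at h1
    simp only [hh, hW, h2]
    have h3 := flipBit_self j (pos k) c
    simp only [noisyBit, h3] at h1 ⊢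
    generalize bitProb _ _ = B
    generalize dataProb δ c x = D at *
    generalize dataProb δ (flipBit j (pos k) c) x = D' at *
    cases hc : c j (pos k) <;> cases hyv : y <;> simp only [hc, hyv, bsc] at h1 ⊢ <;>
      simp only [Bool.not_true, Bool.not_false, if_true, if_false, reduceCtorEq] at h1 ⊢
    · linear_combination 2 * B * (1 - δ) * h1
    · linear_combination -2 * B * (1 - δ) * h1
    · linear_combination -2 * B * (1 - δ) * h1
    · linear_combination 2 * B * (1 - δ) * h1
  have hzero : ∑ c, h c = 0 := by
    have hperm : ∑ c, h (flipBit j (pos k) c) = ∑ c, h c := Equiv.sum_comp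
      (Function.Involutive.toPerm (flipBit j (pos k)) (flipBit_flipBit j (pos k))) h
    simp only [hpair, Finset.sum_neg_distrib] at hperm
    linarith
  rw [Finset.mul_sum, ← sub_eq_zero, ← Finset.sum_sub_distrib, ← hzero]
  refine Finset.sum_congr rfl fun c _ => ?_
  simp only [hh, hW]
  ring

theorem isKnown_singletonSet_iff {x : Dataset N n d} {j : Fin N} {k : Fin d} :
    IsKnown (singletonSet x) j k ↔
      ∃ i ∈ singletonIndices x, (x i).1.1 = j ∧ (k : ℕ) < (x i).1.2.1 := by
  constructor
  · rintro ⟨e, he, hid, hk⟩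
    obtain ⟨i, hi, rfl⟩ := Finset.mem_image.1 he
    exact ⟨i, hi, hid, hk⟩
  · rintro ⟨i, hi, hid, hk⟩
    exact ⟨x i, mem_singletonSet hi, hid, hk⟩

/-- A sum over all positions of a function supported on the known ones runs over the feature bits
of the singletons. -/
theorem sum_isKnown (x : Dataset N n d) (f : Fin N → Fin d → ℝ)
    (hf : ∀ j k, ¬ IsKnown (singletonSet x) j k → f j k = 0) :
    ∑ j, ∑ k, f j k =
      ∑ i ∈ singletonIndices x, ∑ k : Fin ((x i).1.2.1 : ℕ), f (x i).1.1 (pos k) := by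
  classical
  have hin : ∀ i ∈ singletonIndices x, ∑ k : Fin ((x i).1.2.1 : ℕ), f (x i).1.1 (pos k) =
      ∑ k, f (x i).1.1 k := by
    intro i hi
    refine Fintype.sum_of_injective (fun k => pos k) (Fin.castLE_injective _) _ _
      (fun k hk => hf _ _ fun hkn => hk ?_) fun _ => rfl
    obtain ⟨i', hi', hid, hlt⟩ := isKnown_singletonSet_iff.1 hkn
    obtain rfl := mem_singletonIndices.1 hi i' hid
    exact ⟨⟨k, hlt⟩, rfl⟩
  rw [Finset.sum_congr rfl hin,
    ← Finset.sum_image (g := fun i => (x i).1.1) (f := fun j => ∑ k, f j k)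
      (id_injOn_singletonIndices x)]
  symm
  refine Finset.sum_subset (Finset.subset_univ _) fun j _ hj =>
    Finset.sum_eq_zero fun k _ => hf j k fun hkn => hj ?_
  obtain ⟨i, hi, hid, -⟩ := isKnown_singletonSet_iff.1 hkn
  exact Finset.mem_image.2 ⟨i, hi, hid⟩

/-- Repeating the stored bits of the singletons lowers the error in proportion to the number of
stored bits that the original predictions miss. -/
theorem sum_predErr_sub (δ : ℝ) {a : Dataset N n d → Input N d → Bool → ℝ}
    (ha : ∀ x z, ∑ b, a x z b = 1) :
    ∑ c : Instance N d, (predErr δ c a - predErr δ c (repeatStored a)) =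
      (1 - δ) ^ 2 / (N * d) * ∑ c : Instance N d, expectedMisses δ c a := by
  classical
  have hdiff : ∀ c : Instance N d, predErr δ c a - predErr δ c (repeatStored a) =
      ∑ x : Dataset N n d, dataProb δ c x *
        ∑ e, exampleProb δ c e * (repeatStored a x e.1 e.2 - a x e.1 e.2) := by
    intro c
    rw [predErr, predErr, ← Finset.sum_sub_distrib]
    refine Finset.sum_congr rfl fun x _ => ?_
    rw [← mul_sub, ← Finset.sum_sub_distrib]
    congr 1
    exact Finset.sum_congr rfl fun e _ => by ring
  have hunknown : ∀ (c : Instance N d) (x : Dataset N n d),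
      ∑ e, exampleProb δ c e * (repeatStored a x e.1 e.2 - a x e.1 e.2) =
        ∑ i ∈ singletonIndices x, ∑ k : Fin ((x i).1.2.1 : ℕ),
          ∑ z : Fin ((pos k : Fin d) : ℕ) → Bool, ∑ b,
            exampleProb δ c (((x i).1.1, ⟨pos k, z⟩), b) *
              (repeatStored a x ((x i).1.1, ⟨pos k, z⟩) b - a x ((x i).1.1, ⟨pos k, z⟩) b) := by
    intro c x
    rw [sum_example]
    refine sum_isKnown x (fun j k => ∑ z : Fin (k : ℕ) → Bool, ∑ b,
      exampleProb δ c ((j, ⟨k, z⟩), b) *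
        (repeatStored a x (j, ⟨k, z⟩) b - a x (j, ⟨k, z⟩) b)) fun j k hjk => ?_
    refine Finset.sum_eq_zero fun z _ => Finset.sum_eq_zero fun b _ => ?_
    rw [repeatStored, if_neg hjk, sub_self, mul_zero]
  have hknown : ∀ (c : Instance N d) (x : Dataset N n d), ∀ i ∈ singletonIndices x,
      ∀ (k : Fin ((x i).1.2.1 : ℕ)) (z : Fin ((pos k : Fin d) : ℕ) → Bool),
      ∑ b, exampleProb δ c (((x i).1.1, ⟨pos k, z⟩), b) *
        (repeatStored a x ((x i).1.1, ⟨pos k, z⟩) b - a x ((x i).1.1, ⟨pos k, z⟩) b) =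
      1 / (N * d) * (1 - a x ((x i).1.1, ⟨pos k, z⟩) ((x i).1.2.2 k)) *
        (bitProb (noisyBit δ c) ((x i).1.1, ⟨pos k, z⟩) *
          (noisyBit δ c (x i).1.1 (pos k) ((x i).1.2.2 k) -
            noisyBit δ c (x i).1.1 (pos k) (!(x i).1.2.2 k))) := by
    intro c x i hi k z
    have hk : IsKnown (singletonSet x) (x i).1.1 (pos k) :=
      isKnown_singletonSet_iff.2 ⟨i, hi, rfl, k.isLt⟩
    have hs := ha x ((x i).1.1, ⟨pos k, z⟩)
    simp only [repeatStored, if_pos hk, readBit_singletonSet hi, exampleProb_eq, predictiveProb]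
    rw [Fintype.sum_bool] at hs ⊢
    generalize bitProb _ _ = B
    cases (x i).1.2.2 k
    · simp only [Bool.not_false, reduceCtorEq, if_true, if_false]
      rw [eq_sub_of_add_eq hs]
      ring
    · simp only [Bool.not_true, reduceCtorEq, if_true, if_false]
      rw [eq_sub_of_add_eq' hs]
      ring
  simp only [hdiff, hunknown]
  rw [Finset.sum_comm]
  unfold expectedMisses missProb
  rw [Finset.sum_comm (s := (Finset.univ : Finset (Instance N d))), Finset.mul_sum]
  refine Finset.sum_congr rfl fun x _ => ?_
  -- For a fixed data set, average over the instances first.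
  simp only [Finset.mul_sum]
  rw [Finset.sum_comm, Finset.sum_comm (s := (Finset.univ : Finset (Instance N d)))]
  refine Finset.sum_congr rfl fun i hi => ?_
  rw [Finset.sum_comm, Finset.sum_comm (s := (Finset.univ : Finset (Instance N d)))]
  refine Finset.sum_congr rfl fun k _ => ?_
  rw [Finset.sum_comm, Finset.sum_comm (s := (Finset.univ : Finset (Instance N d)))]
  refine Finset.sum_congr rfl fun z _ => ?_
  have hpost := sum_dataProb_mul_sub δ hi k z
  simp only [← Finset.mul_sum, hknown _ x i hi k z]
  calc _ = 1 / (N * d) * (1 - a x ((x i).1.1, ⟨pos k, z⟩) ((x i).1.2.2 k)) *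
        ∑ c : Instance N d, dataProb δ c x *
          bitProb (noisyBit δ c) ((x i).1.1, ⟨pos k, z⟩) *
          (noisyBit δ c (x i).1.1 (pos k) ((x i).1.2.2 k) -
            noisyBit δ c (x i).1.1 (pos k) (!(x i).1.2.2 k)) := by
        rw [Finset.mul_sum]
        exact Finset.sum_congr rfl fun c _ => by ring
    _ = _ := by
        rw [hpost]
        simp only [Finset.mul_sum]
        exact Finset.sum_congr rfl fun c _ => by ring

/-- An `ε`-suboptimal learner misses few of the stored bits. -/
theorem IsSuboptimal.expInstance_expectedMisses_le {δ ε : ℝ} (h0 : 0 < δ) (h1 : δ < 1)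
    (hN : 1 ≤ N) (hd : 1 ≤ d) {A : Learner.{u} N n d} (hA : IsSuboptimal δ ε A) :
    expInstance (fun c => expectedMisses δ c (predProb A)) ≤ ε * (N * d) / (1 - δ) ^ 2 := by
  obtain ⟨A', hA'⟩ := exists_learner.{u} (repeatStored (predProb A))
    (fun x z b => by
      unfold repeatStored
      split_ifs
      exacts [zero_le_one, le_rfl, predProb_nonneg A x z b])
    (fun x z => by
      unfold repeatStored
      split_ifs
      exacts [by simp, sum_predProb A x z])
  have hle := hA.err_le h0 h1 hN A'
  rw [err_eq, err_eq, hA'] at hle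
  have hsub : expInstance (fun c => predErr δ c (predProb A)) -
      expInstance (fun c => predErr δ c (repeatStored (predProb A))) =
      (1 - δ) ^ 2 / (N * d) * expInstance (fun c => expectedMisses δ c (predProb A)) := by
    unfold expInstance
    rw [← sub_div, ← Finset.sum_sub_distrib, sum_predErr_sub δ (sum_predProb A), mul_div_assoc]
  have hNd : (0 : ℝ) < N * d := by positivity
  have hδ : 0 < (1 - δ) ^ 2 := by have : 0 < 1 - δ := by linarith
                                  positivity
  rw [le_div_iff₀ hδ]
  have h2 : (1 - δ) ^ 2 / (N * d) * expInstance (fun c => expectedMisses δ c (predProb A)) ≤ ε := by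
    linarith
  rw [div_mul_eq_mul_div, div_le_iff₀ hNd] at h2
  linarith

/-! ### Averaging over the problem instance and asymptotics -/

theorem expInstance_mono {f g : Instance N d → ℝ} (h : ∀ c, f c ≤ g c) :
    expInstance f ≤ expInstance g :=
  div_le_div_of_nonneg_right (Finset.sum_le_sum fun c _ => h c) (Nat.cast_nonneg _)

theorem expInstance_const (r : ℝ) : expInstance (fun _ : Instance N d => r) = r := by
  have : (Fintype.card (Instance N d) : ℝ) ≠ 0 := by exact_mod_cast Fintype.card_ne_zero
  rw [expInstance, Finset.sum_const, Finset.card_univ, nsmul_eq_mul, mul_div_cancel_left₀ _ this]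

theorem expInstance_add (f g : Instance N d → ℝ) :
    expInstance (fun c => f c + g c) = expInstance f + expInstance g := by
  rw [expInstance, Finset.sum_add_distrib, add_div, expInstance, expInstance]

theorem expInstance_const_mul (r : ℝ) (f : Instance N d → ℝ) :
    expInstance (fun c => r * f c) = r * expInstance f := by
  rw [expInstance, ← Finset.mul_sum, mul_div_assoc, expInstance]

theorem expInstance_mul_const (r : ℝ) (f : Instance N d → ℝ) :
    expInstance (fun c => f c * r) = expInstance f * r := by
  rw [expInstance, ← Finset.sum_mul, mul_div_right_comm, expInstance]

theorem entropyRate_mul_le_singletonSetEntropy {δ : ℝ} (h0 : 0 < δ) (h1 : δ < 1) (hn : 1 ≤ n)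
    (hd : 1 ≤ d) : entropyRate δ * (n * d) ≤ singletonSetEntropy δ n n d * Real.log 2 := by
  rw [singletonSetEntropy, ← expInstance_mul_const,
    ← expInstance_const (N := n) (d := d) (entropyRate δ * (n * d))]
  exact expInstance_mono fun c => entropyRate_mul_le_entropy_singletonSet h0 h1 hn hd c

theorem entropyRate_mul_le_singletonFamilyEntropy {δ : ℝ} (h0 : 0 < δ) (h1 : δ < 1)
    (hn : 1 ≤ n) (hd : 1 ≤ d) :
    entropyRate δ * (n * d) ≤ singletonFamilyEntropy δ n n d * Real.log 2 := by
  rw [singletonFamilyEntropy, ← expInstance_mul_const,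
    ← expInstance_const (N := n) (d := d) (entropyRate δ * (n * d))]
  exact expInstance_mono fun c => entropyRate_mul_le_entropy_singletonFamily h0 h1 hn hd c

theorem singletonSetEntropy_le {δ : ℝ} (h0 : 0 < δ) (h1 : δ < 1) (hn : 1 ≤ n) (hd : 1 ≤ d) :
    singletonSetEntropy δ n n d * Real.log 2 ≤
      expInstance (N := n) (d := d) (featInfo δ n) +
        n * d * ((1 - Real.log (δ / 2)) / d + Real.log d / d) := by
  have hd' : (d : ℝ) ≠ 0 := by positivity
  have : (n : ℝ) * d * ((1 - Real.log (δ / 2)) / d + Real.log d / d) =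
      n + n * (Real.log d - Real.log (δ / 2)) := by field_simp; ring
  rw [singletonSetEntropy, ← expInstance_mul_const, this,
    ← expInstance_const (N := n) (d := d) (n + n * (Real.log d - Real.log (δ / 2))),
    ← expInstance_add]
  exact expInstance_mono fun c => entropy_singletonSet_le h0 h1 hn hd c

theorem singletonFamilyEntropy_le {δ : ℝ} (h0 : 0 < δ) (h1 : δ < 1) (hn : 1 ≤ n)
    (hd : 1 ≤ d) :
    singletonFamilyEntropy δ n n d * Real.log 2 ≤
      expInstance (N := n) (d := d) (featInfo δ n) +
        n * d * ((Real.log 2 - Real.log (δ / 2)) / d + Real.log d / d + Real.log n / d) := by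
  have hd' : (d : ℝ) ≠ 0 := by positivity
  have : (n : ℝ) * d * ((Real.log 2 - Real.log (δ / 2)) / d + Real.log d / d + Real.log n / d) =
      n * Real.log 2 + n * (Real.log n + Real.log d - Real.log (δ / 2)) := by field_simp; ring
  rw [singletonFamilyEntropy, ← expInstance_mul_const, this,
    ← expInstance_const (N := n) (d := d)
      (n * Real.log 2 + n * (Real.log n + Real.log d - Real.log (δ / 2))),
    ← expInstance_add]
  exact expInstance_mono fun c => entropy_singletonFamily_le h0 h1 hn hd c

/-- A suboptimal learner retains the information of the feature bits of the singletons, up to a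
small fraction of `n * d`. -/
theorem IsSuboptimal.le_condMutualInfo {δ ε : ℝ} (h0 : 0 < δ) (h1 : δ < 1) (hn : 1 ≤ n)
    (hd : 1 ≤ d) {A : Learner.{u} n n d} (hA : IsSuboptimal δ ε A) {t : ℝ} (ht0 : 0 < t)
    (ht1 : t < 1 / 2) :
    expInstance (N := n) (d := d) (featInfo δ n) +
      n * d * (Real.log (1 - t) + Real.log t * (ε / (1 - δ) ^ 2)) ≤
      condMutualInfo δ A * Real.log 2 := by
  have hmiss := hA.expInstance_expectedMisses_le h0 h1 hn hd
  have hlog : Real.log t ≤ 0 := Real.log_nonpos ht0.le (by linarith)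
  have hmul := mul_le_mul_of_nonpos_left hmiss hlog
  have hle := expInstance_mono fun c => le_mutualInfo_train h0 h1 hn hd c A ht0 ht1
  rw [expInstance_add, expInstance_add, expInstance_const, expInstance_const_mul,
    expInstance_mul_const] at hle
  refine le_trans ?_ hle
  rw [mul_add]
  have : n * d * (Real.log t * (ε / (1 - δ) ^ 2)) =
      Real.log t * (ε * (n * d) / (1 - δ) ^ 2) := by ring
  rw [this]
  exact add_le_add_right (add_le_add_right hmul _) _

theorem condMutualInfo_nonneg (δ : ℝ) (A : Learner.{u} N n d) : 0 ≤ condMutualInfo δ A :=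
  div_nonneg (Finset.sum_nonneg fun _ _ => mutualInfo_nonneg _ _) (Nat.cast_nonneg _)

theorem exists_tendsto_zero_mul_le {H I : ℕ → ℝ} (hI : ∀ k, 0 ≤ I k)
    (h : ∀ γ > 0, ∀ᶠ k in atTop, (1 - γ) * H k ≤ I k) :
    ∃ η : ℕ → ℝ, Tendsto η atTop (𝓝 0) ∧ ∀ k, (1 - η k) * H k ≤ I k := by
  refine ⟨fun k => if H k ≤ 0 then 0 else max 0 (1 - I k / H k), ?_, fun k => ?_⟩
  · rw [Metric.tendsto_atTop']
    intro γ hγ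
    obtain ⟨k₀, hk₀⟩ := eventually_atTop.1 (h (γ / 2) (half_pos hγ))
    refine ⟨k₀, fun k hk => ?_⟩
    split_ifs with hH
    · simpa using hγ
    · have hH' : 0 < H k := not_le.1 hH
      have h1 : 1 - γ / 2 ≤ I k / H k := (le_div_iff₀ hH').2 (hk₀ k hk.le)
      rw [Real.dist_eq, sub_zero, abs_of_nonneg (le_max_left _ _)]
      exact max_lt hγ (by linarith)
  · dsimp only
    split_ifs with hH
    · linarith [hI k]
    · have hH' : 0 < H k := not_le.1 hH
      have h1 := le_max_right 0 (1 - I k / H k)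
      have h2 : 1 - max 0 (1 - I k / H k) ≤ I k / H k := by linarith
      exact (le_div_iff₀ hH').1 h2

/-- If an entropy `H` is at least of order `n * d` and exceeds the information content of the
feature bits of the singletons by at most `o(n * d)`, then learners with vanishing suboptimality
retain all but a vanishing fraction of `H`. -/
theorem exists_tendsto_zero_mul_le_condMutualInfo {δ : ℝ} (h0 : 0 < δ) (h1 : δ < 1)
    {n d : ℕ → ℕ} {ε : ℕ → ℝ} (hn : ∀ k, 1 ≤ n k) (hd : Tendsto d atTop atTop)
    (hε : Tendsto ε atTop (𝓝 0)) {A : ∀ k, Learner.{u} (n k) (n k) (d k)}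
    (hA : ∀ k, IsSuboptimal δ (ε k) (A k)) {H ρ : ℕ → ℝ} (hρ : Tendsto ρ atTop (𝓝 0))
    (hlow : ∀ k, 1 ≤ d k → entropyRate δ * (n k * d k) ≤ H k * Real.log 2)
    (hupp : ∀ k, 1 ≤ d k → H k * Real.log 2 ≤
      expInstance (N := n k) (d := d k) (featInfo δ (n k)) + n k * d k * ρ k) :
    ∃ η : ℕ → ℝ, Tendsto η atTop (𝓝 0) ∧ ∀ k, (1 - η k) * H k ≤ condMutualInfo δ (A k) := by
  refine exists_tendsto_zero_mul_le (fun k => condMutualInfo_nonneg δ (A k)) fun γ hγ => ?_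
  have hrate := entropyRate_pos h0 h1
  have hγr : 0 < γ * entropyRate δ := mul_pos hγ hrate
  -- The smoothing parameter is fixed first, and only then does `ε` tend to zero.
  obtain ⟨t, ht0, ht1, ht⟩ : ∃ t : ℝ, 0 < t ∧ t < 1 / 2 ∧
      -Real.log (1 - t) < γ * entropyRate δ / 2 := by
    have hcont : Tendsto (fun t : ℝ => -Real.log (1 - t)) (𝓝[>] 0) (𝓝 0) := by
      have : ContinuousAt (fun t : ℝ => -Real.log (1 - t)) 0 :=
        ((continuousAt_const.sub continuousAt_id).log (by simp)).neg
      have := this.tendsto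
      simp only [sub_zero, Real.log_one, neg_zero] at this
      exact this.mono_left nhdsWithin_le_nhds
    obtain ⟨t, ht, ht'⟩ := ((hcont.eventually_lt_const (half_pos hγr)).and
      (Ioo_mem_nhdsGT (by norm_num : (0 : ℝ) < 1 / 2))).exists
    exact ⟨t, ht'.1, ht'.2, ht⟩
  have hlim : Tendsto (fun k => ρ k - Real.log t * (ε k / (1 - δ) ^ 2)) atTop (𝓝 0) := by
    simpa using hρ.sub ((hε.div_const ((1 - δ) ^ 2)).const_mul (Real.log t))
  filter_upwards [hd.eventually_ge_atTop 1, hlim.eventually_lt_const (half_pos hγr)]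
    with k hdk hk
  have hI := (hA k).le_condMutualInfo h0 h1 (hn k) hdk ht0 ht1
  have hlog2 := Real.log_pos one_lt_two
  have hbr : ρ k - (Real.log (1 - t) + Real.log t * (ε k / (1 - δ) ^ 2)) ≤
      γ * entropyRate δ := by linarith
  have hnd : (0 : ℝ) ≤ n k * d k := by positivity
  have h3 := mul_le_mul_of_nonneg_left hbr hnd
  have h4 := mul_le_mul_of_nonneg_left (hlow k hdk) hγ.le
  have h5 := hupp k hdk
  refine le_of_mul_le_mul_right ?_ hlog2
  rw [mul_sub] at h3
  linarith

end NSP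

end

theorem mainTheorem2 (δ : ℝ) (hδ0 : 0 < δ) (hδ1 : δ < 1) :
    (∃ b : ℝ, 0 < b ∧ ∀ n d : ℕ, 1 ≤ n → 1 ≤ d →
      b * (n * d) ≤ NSP.singletonSetEntropy δ n n d ∧
      b * (n * d) ≤ NSP.singletonFamilyEntropy δ n n d) ∧
    (∀ (n d : ℕ → ℕ) (ε : ℕ → ℝ), (∀ k, 1 ≤ n k) → Tendsto d atTop atTop →
      Tendsto ε atTop (𝓝 0) →
      ∀ A : ∀ k, NSP.Learner (n k) (n k) (d k), (∀ k, NSP.IsSuboptimal δ (ε k) (A k)) →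
        (∃ η : ℕ → ℝ, Tendsto η atTop (𝓝 0) ∧ ∀ k,
          (1 - η k) * NSP.singletonSetEntropy δ (n k) (n k) (d k) ≤
            NSP.condMutualInfo δ (A k)) ∧
        (Tendsto (fun k => Real.log (n k) / d k) atTop (𝓝 0) →
          ∃ η : ℕ → ℝ, Tendsto η atTop (𝓝 0) ∧ ∀ k,
            (1 - η k) * NSP.singletonFamilyEntropy δ (n k) (n k) (d k) ≤
              NSP.condMutualInfo δ (A k))) := by
  have hlog2 := Real.log_pos one_lt_two
  refine ⟨⟨NSP.entropyRate δ / Real.log 2, div_pos (NSP.entropyRate_pos hδ0 hδ1) hlog2,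
    fun n d hn hd => ?_⟩, fun n d ε hn hd hε A hA => ?_⟩
  · rw [div_mul_eq_mul_div, div_le_iff₀ hlog2, div_le_iff₀ hlog2]
    exact ⟨NSP.entropyRate_mul_le_singletonSetEntropy hδ0 hδ1 hn hd,
      NSP.entropyRate_mul_le_singletonFamilyEntropy hδ0 hδ1 hn hd⟩
  · have hcast : Tendsto (fun k => (d k : ℝ)) atTop atTop :=
      tendsto_natCast_atTop_atTop.comp hd
    have hlogd : Tendsto (fun k => Real.log (d k) / d k) atTop (𝓝 0) :=
      Real.isLittleO_log_id_atTop.tendsto_div_nhds_zero.comp hcast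
    refine ⟨?_, fun hlogn => ?_⟩
    · refine NSP.exists_tendsto_zero_mul_le_condMutualInfo hδ0 hδ1 hn hd hε hA
        (ρ := fun k => (1 - Real.log (δ / 2)) / d k + Real.log (d k) / d k) ?_
        (fun k hk => NSP.entropyRate_mul_le_singletonSetEntropy hδ0 hδ1 (hn k) hk)
        fun k hk => NSP.singletonSetEntropy_le hδ0 hδ1 (hn k) hk
      simpa using (hcast.const_div_atTop _).add hlogd
    · refine NSP.exists_tendsto_zero_mul_le_condMutualInfo hδ0 hδ1 hn hd hε hA
        (ρ := fun k => (Real.log 2 - Real.log (δ / 2)) / d k + Real.log (d k) / d k +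
          Real.log (n k) / d k) ?_
        (fun k hk => NSP.entropyRate_mul_le_singletonFamilyEntropy hδ0 hδ1 (hn k) hk)
        fun k hk => NSP.singletonFamilyEntropy_le hδ0 hδ1 (hn k) hk
      simpa using ((hcast.const_div_atTop _).add hlogd).add hlogn
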